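/- **Notation.** Let $d,T$ be natural numbers. Points of $\mathbb{R}^{dT}$ are paths $x=(x_1,\dots,x_T)$ with $x_t\in\mathbb{R}^d$; write $x_{1:t}=(x_1,\dots,x_t)$, and let $\|\cdot\|$ be the Euclidean norm. For a Borel probability measure $\mu$ on $\mathbb{R}^{dT}$ let $\mu_{1:t}$ be the law of $x_{1:t}$, let $\mu_{x_{1:t}}$ be a regular conditional law of $x_{t+1:T}$ given $x_{1:t}$ (so $\mu_{x_{1:0}}=\mu$), and let $\mu^{t+1}_{x_{1:t}}$ be the $x_{t+1}$-marginal of $\mu_{x_{1:t}}$. Use the analogous notation $\pi_{1:t}$, $\pi_{x_{1:t},y_{1:t}}$ for probability measures $\pi$ on $\mathbb{R}^{dT}\times\mathbb{R}^{dT}$. Let $\mathrm{Cpl}(\mu,\nu)$ be the set of couplings of $\mu$ and $\nu$, and let $\mathrm{Cpl}_{\mathrm{bc}}(\mu,\nu)$ be the set of bi-causal couplings, i.e. of those $\pi\in\mathrm{Cpl}(\mu,\nu)$ such that for every $t=0,\dots,T-1$ one has $\pi_{x_{1:t},y_{1:t}}\in\mathrm{Cpl}(\mu_{x_{1:t}},\nu_{y_{1:t}})$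 for $\pi_{1:t}$-almost every $(x_{1:t},y_{1:t})$. Set $$\mathcal{AW}_2^2(\mu,\nu)=\inf_{\pi\in\mathrm{Cpl}_{\mathrm{bc}}(\mu,\nu)}\int\sum_{t=1}^T\|x_t-y_t\|^2\,\pi(dx,dy),$$ and use the same definitions on path spaces of any other length, in particular for $\mu_{x_{1:t}}$ (length $T-t$) and $\mu^{t+1}_{x_{1:t}}$ (length $1$). **Proposition (dynamic programming principle).** Let $\mu,\nu$ be Borel probability measures on $\mathbb{R}^{dT}$ with finite second moments. Set $V_T^{\mu,\nu}\equiv 0$ and, for $t=T-1,\dots,0$, define $$V_t^{\mu,\nu}(x_{1:t},y_{1:t})=\inf_{\pi\in\mathrm{Cpl}_{\mathrm{bc}}(\mu^{t+1}_{x_{1:t}},\,\nu^{t+1}_{y_{1:t}})}\int\Big[\|x_{t+1}-y_{t+1}\|^2+V_{t+1}^{\mu,\nu}(x_{1:t+1},y_{1:t+1})\Big]\,\pi(dx_{t+1},dy_{t+1}).$$ Then for every $t=0,\dots,T-1$ there are sets $A_t,B_t\subseteq\mathbb{R}^{dt}$ of full $\mu_{1:t}$-measure and full $\nu_{1:t}$-measure,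 respectively, such that $$V_t^{\mu,\nu}(x_{1:t},y_{1:t})=\mathcal{AW}_2^2(\mu_{x_{1:t}},\nu_{y_{1:t}})<\infty\qquad\text{for all }x_{1:t}\in A_t,\ y_{1:t}\in B_t.$$ In particular $V_0^{\mu,\nu}=\mathcal{AW}_2^2(\mu,\nu)<\infty$. -/

import Mathlib

open MeasureTheory ProbabilityTheory
open scoped ENNReal

namespace NestedOT

/-- The space `ℝ^{dn}` of `d`-dimensional paths `x = (x_1, …, x_n)` with `n` time steps (the time
index is shifted by one: `x i` is the value at time `i + 1`). Every `x i` carries the Euclidean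
norm; the Euclidean norm of a whole path is always written out as `∑ i, ‖x i‖ ^ 2`. -/
abbrev PathSpace (d n : ℕ) : Type := Fin n → EuclideanSpace ℝ (Fin d)

variable {d T : ℕ}

/-- `x ↦ x_{1:t}`. -/
def past (t : ℕ) (ht : t ≤ T) (x : PathSpace d T) : PathSpace d t :=
  fun i => x (Fin.castLE ht i)

/-- `x ↦ x_{t+1:T}`. -/
def future (t : ℕ) (x : PathSpace d T) : PathSpace d (T - t) :=
  fun i => x ⟨t + i, by omega⟩

lemma measurable_past (t : ℕ) (ht : t ≤ T) :
    Measurable (past t ht : PathSpace d T → PathSpace d t) :=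
  measurable_pi_lambda _ fun _ => measurable_pi_apply _

/-- `μ ∈ 𝒫₂(ℝ^{dT})`. -/
def FiniteSecondMoment (μ : ProbabilityMeasure (PathSpace d T)) : Prop :=
  ∫⁻ x, ∑ i, ‖x i‖ₑ ^ 2 ∂(μ : Measure (PathSpace d T)) < ∞

/-- The marginal `μ_{1:t}`. -/
noncomputable def pastLaw (μ : ProbabilityMeasure (PathSpace d T)) (t : ℕ) (ht : t ≤ T) :
    ProbabilityMeasure (PathSpace d t) :=
  μ.map (measurable_past t ht).aemeasurable

/-- The marginal `π_{1:t}` of a law `π` on pairs of paths, i.e. the law of `(x_{1:t}, y_{1:t})`. -/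
noncomputable def pairPastLaw (π : ProbabilityMeasure (PathSpace d T × PathSpace d T))
    (t : ℕ) (ht : t ≤ T) : ProbabilityMeasure (PathSpace d t × PathSpace d t) :=
  π.map ((measurable_past t ht).prodMap (measurable_past t ht)).aemeasurable

/-- The conditional law `μ_{x_{1:t}}` of `x_{t+1:T}` given `x_{1:t}` under `μ`
(a regular conditional distribution). -/
noncomputable def condLaw (μ : ProbabilityMeasure (PathSpace d T)) (t : ℕ) (ht : t ≤ T)
    (x : PathSpace d t) : ProbabilityMeasure (PathSpace d (T - t)) :=
  ⟨condDistrib (future t) (past t ht) (μ : Measure (PathSpace d T)) x, inferInstance⟩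

/-- The conditional law `π_{x_{1:t}, y_{1:t}}` of `(x_{t+1:T}, y_{t+1:T})` given
`(x_{1:t}, y_{1:t})` under `π`. -/
noncomputable def pairCondLaw (π : ProbabilityMeasure (PathSpace d T × PathSpace d T))
    (t : ℕ) (ht : t ≤ T) (p : PathSpace d t × PathSpace d t) :
    ProbabilityMeasure (PathSpace d (T - t) × PathSpace d (T - t)) :=
  ⟨condDistrib (Prod.map (future t) (future t)) (Prod.map (past t ht) (past t ht))
    (π : Measure (PathSpace d T × PathSpace d T)) p, inferInstance⟩

/-- The one-step conditional law `μ_{x_{1:t}}^{t+1}`, i.e. the image of `μ_{x_{1:t}}` under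
`x_{t+1:T} ↦ x_{t+1}`, regarded as a law of paths with a single time step. -/
noncomputable def nextLaw (μ : ProbabilityMeasure (PathSpace d T)) (t : ℕ) (ht : t < T)
    (x : PathSpace d t) : ProbabilityMeasure (PathSpace d 1) :=
  pastLaw (condLaw μ t ht.le x) 1 (by omega)

/-- The set `Cpl(μ, ν)` of couplings. -/
def Cpl (μ ν : ProbabilityMeasure (PathSpace d T)) :
    Set (ProbabilityMeasure (PathSpace d T × PathSpace d T)) :=
  {π | π.map measurable_fst.aemeasurable = μ ∧ π.map measurable_snd.aemeasurable = ν}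

/-- The set `Cpl_bc(μ, ν)` of bi-causal couplings: `π_{x_{1:t}, y_{1:t}}` is a coupling of
`μ_{x_{1:t}}` and `ν_{y_{1:t}}` for all `t = 0, …, T - 1` and `π_{1:t}`-almost all
`(x_{1:t}, y_{1:t})`. -/
def CplBC (μ ν : ProbabilityMeasure (PathSpace d T)) :
    Set (ProbabilityMeasure (PathSpace d T × PathSpace d T)) :=
  {π | π ∈ Cpl μ ν ∧ ∀ (t : ℕ) (ht : t < T),
    ∀ᵐ p ∂(pairPastLaw π t ht.le : Measure (PathSpace d t × PathSpace d t)),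
      pairCondLaw π t ht.le p ∈ Cpl (condLaw μ t ht.le p.1) (condLaw ν t ht.le p.2)}

/-- The squared adapted Wasserstein-2 distance `𝒜𝒲₂²(μ, ν)`, with values in `[0, ∞]`. -/
noncomputable def AW2sq (μ ν : ProbabilityMeasure (PathSpace d T)) : ℝ≥0∞ :=
  ⨅ π ∈ CplBC μ ν, ∫⁻ p, ∑ i, ‖p.1 i - p.2 i‖ₑ ^ 2
    ∂(π : Measure (PathSpace d T × PathSpace d T))

/-- The value functions `V_t^{μ,ν}(x_{1:t}, y_{1:t})`, defined backward from `V_T = 0`.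
(For the meaningless indices `t > T` the value is `0` as well.) -/
noncomputable def valueFn (μ ν : ProbabilityMeasure (PathSpace d T)) (t : ℕ)
    (x y : PathSpace d t) : ℝ≥0∞ :=
  if ht : t < T then
    ⨅ π ∈ CplBC (nextLaw μ t ht x) (nextLaw ν t ht y),
      ∫⁻ p, (‖p.1 0 - p.2 0‖ₑ ^ 2
          + valueFn μ ν (t + 1) (Fin.append x p.1) (Fin.append y p.2))
        ∂(π : Measure (PathSpace d 1 × PathSpace d 1))
  else 0
termination_by T - t

end NestedOT

open NestedOT

/-! Every bi-causal coupling is a composition of one-step couplings of the conditional laws, and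
conversely. Along any bi-causal coupling, running cost plus value is a submartingale, so `V_0`
bounds its cost from below (`valueFn_zero_le_AW2sq`); along the composition of optimal one-step
couplings the expectation of this process is constant, so `V_0` is attained
(`valueFn_zero_eq_AW2sq`).

Two points need work. The first is measurability: the value functions must be jointly measurable and
optimal couplings must form kernels. For this, costs are considered that become lower semicontinuous
on a product of compact metrizable spaces after each variable is recoded separately
(`LscEncodable`). This class is stable under a dynamic programming step (`LscEncodable.otCost`): a
state is recoded by the law of its recoded successor, a point of the again compact space of
probability measures, where the transport cost is lower semicontinuous and minimizers are selected
measurably. Hence everything stays Borel. The second is that the composed law is bi-causal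
(`exists_mem_CplBC_of_kernels`). Each marginal of a one-step coupling depends only on its own past,
and the tower property carries this over to the whole future.

The case of general `t` is time zero applied to the conditional laws: for almost every past their
one-step laws are those of the original measure (`ae_nextKernel_condLaw`), so their value functions
are the shifted ones (`valueFn_condLaw_eq`). -/

namespace NestedOT

open Set Filter TopologicalSpace
open scoped Topology

/-! ### Measurable selection of minimizers over compact sections. -/

section Selection

variable {Y M : Type*} [TopologicalSpace Y] [TopologicalSpace M] [CompactSpace M]
  {G : Set (Y × M)} {h : M → ℝ≥0∞}

/-- Projection along a compact factor is a closed map. -/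
lemma isClosed_exists_mem_le (hG : IsClosed G) (hh : LowerSemicontinuous h) {F : Set M}
    (hF : IsClosed F) (a : ℝ≥0∞) : IsClosed {y | ∃ x ∈ F, (y, x) ∈ G ∧ h x ≤ a} := by
  have h1 : IsClosed (G ∩ Prod.snd ⁻¹' (F ∩ h ⁻¹' Iic a)) :=
    hG.inter ((hF.inter (lowerSemicontinuous_iff_isClosed_preimage.1 hh a)).preimage
      continuous_snd)
  convert! isClosedMap_fst_of_compactSpace _ h1 using 1
  ext y
  constructor
  · rintro ⟨x, hx, hyx, hle⟩
    exact ⟨(y, x), ⟨hyx, hx, hle⟩, rfl⟩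
  · rintro ⟨⟨y', x⟩, ⟨hyx, hx, hle⟩, rfl⟩
    exact ⟨x, hx, hyx, hle⟩

omit [CompactSpace M] in
lemma isClosed_section (hG : IsClosed G) (y : Y) : IsClosed {x | (y, x) ∈ G} :=
  hG.preimage (Continuous.prodMk_right y)

lemma exists_isMinOn_section (hG : IsClosed G) (hh : LowerSemicontinuous h) {F : Set M}
    (hF : IsClosed F) {y : Y} (hne : ∃ x ∈ F, (y, x) ∈ G) :
    ∃ x ∈ F, (y, x) ∈ G ∧ ∀ x' ∈ F, (y, x') ∈ G → h x ≤ h x' := by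
  obtain ⟨x, hx, hmin⟩ := LowerSemicontinuousOn.exists_isMinOn (f := h)
    (s := F ∩ {x | (y, x) ∈ G}) (by obtain ⟨x, hx, hy⟩ := hne; exact ⟨x, hx, hy⟩)
    (hF.inter (isClosed_section hG y)).isCompact (hh.lowerSemicontinuousOn _)
  exact ⟨x, hx.1, hx.2, fun x' h1 h2 => hmin ⟨h1, h2⟩⟩

/-- The infimum over the sections of a closed set with compact second factor is lower
semicontinuous. -/
lemma lowerSemicontinuous_iInf_section (hG : IsClosed G) (hh : LowerSemicontinuous h)
    (hne : ∀ y, ∃ x, (y, x) ∈ G) :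
    LowerSemicontinuous fun y => ⨅ x ∈ {x | (y, x) ∈ G}, h x := by
  refine lowerSemicontinuous_iff_isClosed_preimage.2 fun a => ?_
  convert! isClosed_exists_mem_le hG hh isClosed_univ a using 1
  ext y
  constructor
  · intro hy
    obtain ⟨x, -, hx, hmin⟩ := exists_isMinOn_section hG hh isClosed_univ
      (y := y) (by simpa using hne y)
    exact ⟨x, mem_univ _, hx, (le_iInf₂ fun x' hx' => hmin x' (mem_univ _) hx').trans hy⟩
  · rintro ⟨x, -, hx, hle⟩
    exact (iInf₂_le (f := fun x (_ : x ∈ {x | (y, x) ∈ G}) => h x) x hx).trans hle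

/-- The minimum over the part of a section in `F` is attained. Hence some minimizer lies in `F`
exactly when `F` meets the section and every level reached on the section is already reached in `F`;
by density countably many levels suffice, and each condition involves only closed sets. -/
lemma measurableSet_exists_argmin [MeasurableSpace Y] [OpensMeasurableSpace Y]
    (hG : IsClosed G) (hh : LowerSemicontinuous h) {F : Set M} (hF : IsClosed F) :
    MeasurableSet {y | ∃ x ∈ F, (y, x) ∈ G ∧ ∀ x', (y, x') ∈ G → h x ≤ h x'} := by
  obtain ⟨D, hDc, hDd⟩ := exists_countable_dense ℝ≥0∞
  have key : {y | ∃ x ∈ F, (y, x) ∈ G ∧ ∀ x', (y, x') ∈ G → h x ≤ h x'} =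
      {y | ∃ x ∈ F, (y, x) ∈ G ∧ h x ≤ ∞} ∩ ⋂ q ∈ D,
        ({y | ∃ x ∈ univ, (y, x) ∈ G ∧ h x ≤ q}ᶜ ∪ {y | ∃ x ∈ F, (y, x) ∈ G ∧ h x ≤ q}) := by
    ext y
    constructor
    · rintro ⟨x, hx, hyx, hmin⟩
      refine ⟨⟨x, hx, hyx, le_top⟩, mem_iInter₂.2 fun q _ => ?_⟩
      by_cases hq : h x ≤ q
      · exact Or.inr ⟨x, hx, hyx, hq⟩
      · refine Or.inl ?_
        rintro ⟨x', -, hx', hle⟩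
        exact hq ((hmin x' hx').trans hle)
    · rintro ⟨⟨x₀, hx₀, hyx₀, -⟩, hD⟩
      obtain ⟨x, hx, hyx, hmin⟩ := exists_isMinOn_section hG hh hF ⟨x₀, hx₀, hyx₀⟩
      refine ⟨x, hx, hyx, fun x' hx' => ?_⟩
      by_contra! hlt
      obtain ⟨q, hqD, hq1, hq2⟩ := hDd.exists_between hlt
      rcases mem_iInter₂.1 hD q hqD with h1 | ⟨x'', h2, h3, h4⟩
      · exact h1 ⟨x', mem_univ _, hx', hq1.le⟩
      · exact absurd ((hmin x'' h2 h3).trans h4) (not_le.2 hq2)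
  rw [key]
  refine (isClosed_exists_mem_le hG hh hF ∞).measurableSet.inter
    (MeasurableSet.biInter hDc fun q _ => ?_)
  exact (isClosed_exists_mem_le hG hh isClosed_univ q).measurableSet.compl.union
    (isClosed_exists_mem_le hG hh hF q).measurableSet

/-- Measurable selection of minimizers over the sections of a closed set with compact metrizable
second factor: among the minimizers one picks the image of the least point of the Cantor set
under a continuous surjection. -/
theorem exists_measurable_argmin [MeasurableSpace Y] [OpensMeasurableSpace Y]
    [MetrizableSpace M] [MeasurableSpace M] [BorelSpace M]
    (hG : IsClosed G) (hh : LowerSemicontinuous h) (hne : ∀ y, ∃ x, (y, x) ∈ G) :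
    ∃ σ : Y → M, Measurable σ ∧ ∀ y, (y, σ y) ∈ G ∧ ∀ x, (y, x) ∈ G → h (σ y) ≤ h x := by
  rcases isEmpty_or_nonempty Y with hY | ⟨⟨y₀⟩⟩
  · exact ⟨fun y => isEmptyElim y, measurable_of_empty _, fun y => isEmptyElim y⟩
  have : Nonempty M := ⟨(hne y₀).choose⟩
  let := metrizableSpaceMetric M
  obtain ⟨φ, hφc, hφs⟩ := exists_nat_bool_continuous_surjective_of_compact M
  set ψ : cantorSet → M := φ ∘ cantorSetHomeomorphNatToBool with hψ
  have hψc : Continuous ψ := hφc.comp cantorSetHomeomorphNatToBool.continuous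
  have hψs : Function.Surjective ψ := hφs.comp cantorSetHomeomorphNatToBool.surjective
  have hcs : IsCompact cantorSet := isCompact_cantorSet
  have : CompactSpace cantorSet := isCompact_iff_compactSpace.1 hcs
  let A : Y → Set M := fun y => {x | (y, x) ∈ G ∧ ∀ x', (y, x') ∈ G → h x ≤ h x'}
  have hAc : ∀ y, IsClosed (A y) := by
    intro y
    have : A y = {x | (y, x) ∈ G} ∩ ⋂ x' ∈ {x' | (y, x') ∈ G}, h ⁻¹' Iic (h x') := by
      ext x; simp [A]
    rw [this]
    exact (isClosed_section hG y).inter (isClosed_biInter fun x' _ =>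
      lowerSemicontinuous_iff_isClosed_preimage.1 hh _)
  have hAne : ∀ y, (A y).Nonempty := by
    intro y
    obtain ⟨x, -, hx, hmin⟩ := exists_isMinOn_section hG hh isClosed_univ
      (y := y) (by simpa using hne y)
    exact ⟨x, hx, fun x' => hmin x' (mem_univ _)⟩
  let S : Y → Set ℝ := fun y => Subtype.val '' (ψ ⁻¹' A y)
  have hSc : ∀ y, IsCompact (S y) := fun y =>
    ((hAc y).preimage hψc).isCompact.image continuous_subtype_val
  have hSne : ∀ y, (S y).Nonempty := by
    intro y
    obtain ⟨x, hx⟩ := hAne y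
    obtain ⟨c, rfl⟩ := hψs x
    exact ⟨c, c, hx, rfl⟩
  have hmem : ∀ y, sInf (S y) ∈ S y := fun y => (hSc y).sInf_mem (hSne y)
  have hsub : ∀ y, sInf (S y) ∈ cantorSet := by
    intro y
    obtain ⟨c, -, hc⟩ := hmem y
    exact hc ▸ c.2
  -- The least code is at most `a` exactly when some minimizer lies in the compact set `ψ '' {c | c
  -- ≤ a}`.
  have hr : Measurable fun y => sInf (S y) := by
    refine measurable_of_Iic fun a => ?_
    have hF : IsClosed (ψ '' {c | (c : ℝ) ≤ a}) :=
      ((isClosed_Iic.preimage continuous_subtype_val).isCompact.image hψc).isClosed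
    convert! measurableSet_exists_argmin hG hh hF using 1
    ext y
    constructor
    · intro hy
      obtain ⟨c, hc, hcy⟩ := hmem y
      exact ⟨ψ c, ⟨c, by simpa [hcy] using hy, rfl⟩, hc⟩
    · rintro ⟨-, ⟨c, hca, rfl⟩, hc⟩
      exact (csInf_le (hSc y).bddBelow ⟨c, hc, rfl⟩).trans hca
  refine ⟨fun y => ψ ⟨sInf (S y), hsub y⟩, hψc.measurable.comp (hr.subtype_mk), fun y => ?_⟩
  obtain ⟨c, hc, hcy⟩ := hmem y
  have : (⟨sInf (S y), hsub y⟩ : cantorSet) = c := Subtype.ext hcy.symm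
  simp only [this]
  exact hc

end Selection

/-! ### Weak topology on probability measures and its Borel sets. -/

section WeakTopology

variable {Z : Type*} [TopologicalSpace Z] [CompactSpace Z] [MetrizableSpace Z]
  [MeasurableSpace Z] [BorelSpace Z]

/-- Integration against a lower semicontinuous function is lower semicontinuous for the weak
topology. -/
lemma lowerSemicontinuous_lintegral {f : Z → ℝ≥0∞} (hf : LowerSemicontinuous f) :
    LowerSemicontinuous fun μ : ProbabilityMeasure Z => ∫⁻ z, f z ∂(μ : Measure Z) := by
  -- Layer cake formula: the superlevel sets are open, so their masses are lower semicontinuous in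
  -- the measure by the portmanteau theorem, and Fatou's lemma integrates this over the levels.
  have hlayer : ∀ μ : ProbabilityMeasure Z, ∫⁻ z, f z ∂(μ : Measure Z) =
      ∫⁻ t in Ioi (0 : ℝ), (μ : Measure Z) {z | ENNReal.ofReal t < f z} := by
    intro μ
    have hpt : ∀ z, f z = ∫⁻ t in Ioi (0 : ℝ), {z | ENNReal.ofReal t < f z}.indicator 1 z := by
      intro z
      have h1 : ∀ t : ℝ, {z | ENNReal.ofReal t < f z}.indicator (1 : Z → ℝ≥0∞) z =
          {t : ℝ | ENNReal.ofReal t < f z}.indicator 1 t := fun t => by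
        simp [indicator_apply]
      simp_rw [h1]
      have hms : MeasurableSet {t : ℝ | ENNReal.ofReal t < f z} :=
        measurableSet_lt ENNReal.measurable_ofReal measurable_const
      rw [lintegral_indicator_one hms, Measure.restrict_apply hms]
      by_cases hz : f z = ∞
      · have : {t : ℝ | ENNReal.ofReal t < f z} ∩ Ioi 0 = Ioi 0 := by
          ext t; simp [hz]
        rw [this, Real.volume_Ioi, hz]
      · have : {t : ℝ | ENNReal.ofReal t < f z} ∩ Ioi 0 = Ioo 0 (f z).toReal := by
          ext t
          simp only [mem_inter_iff, mem_Ioi, mem_Ioo]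
          constructor
          · rintro ⟨h2, h3⟩
            exact ⟨h3, (ENNReal.ofReal_lt_iff_lt_toReal h3.le hz).1 h2⟩
          · rintro ⟨h2, h3⟩
            exact ⟨(ENNReal.ofReal_lt_iff_lt_toReal h2.le hz).2 h3, h2⟩
        rw [this, Real.volume_Ioo, sub_zero, ENNReal.ofReal_toReal hz]
    have hms2 : MeasurableSet {p : Z × ℝ | ENNReal.ofReal p.2 < f p.1} :=
      measurableSet_lt (ENNReal.measurable_ofReal.comp measurable_snd)
        (hf.measurable.comp measurable_fst)
    calc ∫⁻ z, f z ∂(μ : Measure Z)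
        = ∫⁻ z, (∫⁻ t in Ioi (0 : ℝ), {z | ENNReal.ofReal t < f z}.indicator 1 z)
            ∂(μ : Measure Z) := lintegral_congr hpt
      _ = ∫⁻ t in Ioi (0 : ℝ), (∫⁻ z, {z : Z | ENNReal.ofReal t < f z}.indicator 1 z
            ∂(μ : Measure Z)) := by
          rw [lintegral_lintegral_swap]
          exact (measurable_one.indicator hms2).aemeasurable
      _ = _ := by
          refine lintegral_congr fun t => ?_
          rw [lintegral_indicator_one]
          exact measurableSet_lt measurable_const hf.measurable
  refine lowerSemicontinuous_iff_le_liminf.2 fun μ => ?_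
  simp_rw [hlayer]
  calc ∫⁻ t in Ioi (0 : ℝ), (μ : Measure Z) {z | ENNReal.ofReal t < f z}
      ≤ ∫⁻ t in Ioi (0 : ℝ), (𝓝 μ).liminf fun ν : ProbabilityMeasure Z =>
          (ν : Measure Z) {z | ENNReal.ofReal t < f z} :=
        lintegral_mono fun t => ProbabilityMeasure.le_liminf_measure_open_of_tendsto tendsto_id
          (hf.isOpen_preimage _)
    _ ≤ _ := by
        refine lintegral_liminf_le fun ν => ?_
        refine Antitone.measurable fun s t hst => measure_mono fun z hz => ?_
        exact (ENNReal.ofReal_le_ofReal hst).trans_lt hz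

/-- The Borel structure of the weak topology on probability measures over a compact metrizable
space is the evaluation structure. -/
instance : BorelSpace (ProbabilityMeasure Z) := by
  have : SecondCountableTopology (ProbabilityMeasure Z) := by
    let := metrizableSpaceMetric (ProbabilityMeasure Z)
    infer_instance
  constructor
  apply le_antisymm
  -- Evaluations are Borel: on open sets they are lower semicontinuous, and a π-λ argument reaches
  -- all Borel sets.
  · have hmeas : ∀ s : Set Z, MeasurableSet s →
        @Measurable _ _ (borel (ProbabilityMeasure Z)) _
          fun μ : ProbabilityMeasure Z => (μ : Measure Z) s := by
      let : MeasurableSpace (ProbabilityMeasure Z) := borel _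
      have : BorelSpace (ProbabilityMeasure Z) := ⟨rfl⟩
      intro s hs
      have hopen : ∀ U : Set Z, IsOpen U →
          Measurable fun μ : ProbabilityMeasure Z => (μ : Measure Z) U := by
        intro U hU
        have := (lowerSemicontinuous_lintegral (hU.lowerSemicontinuous_indicator
          (zero_le (a := (1 : ℝ≥0∞))))).measurable
        simpa [lintegral_indicator hU.measurableSet] using this
      induction s, hs using MeasurableSpace.induction_on_inter
        (BorelSpace.measurable_eq (α := Z)) isPiSystem_isOpen with
      | empty => simp
      | basic U hU => exact hopen U hU
      | compl s hs ih =>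
        simp_rw [prob_compl_eq_one_sub hs]
        exact measurable_const.sub ih
      | iUnion f hd hm ih =>
        simp_rw [measure_iUnion hd hm]
        exact Measurable.tsum ih
    have : @Measurable _ _ (borel (ProbabilityMeasure Z)) _
        (fun μ : ProbabilityMeasure Z => (μ : Measure Z)) :=
      @Measure.measurable_of_measurable_coe _ _ _ (borel _) _ hmeas
    exact this.comap_le
  -- Conversely, the weak topology has the subbasis given by integrals of test functions, which are
  -- measurable for the evaluation structure; second countability makes a subbasis generate the
  -- Borel sets.
  · have htop : (inferInstance : TopologicalSpace (ProbabilityMeasure Z)) =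
        TopologicalSpace.induced (fun μ (f : BoundedContinuousFunction Z NNReal) =>
          μ.toFiniteMeasure.testAgainstNN f) Pi.topologicalSpace := by
      change TopologicalSpace.induced _ (TopologicalSpace.induced _
        (TopologicalSpace.induced _ _)) = _
      rw [induced_compose]
      exact induced_compose
    rw [pi_eq_generateFrom, induced_generateFrom_eq] at htop
    rw [borel_eq_generateFrom_of_subbasis htop]
    refine MeasurableSpace.generateFrom_le ?_
    rintro _ ⟨_, ⟨s, i, hs, rfl⟩, rfl⟩
    have : (fun (μ : ProbabilityMeasure Z) (f : BoundedContinuousFunction Z NNReal) =>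
          μ.toFiniteMeasure.testAgainstNN f) ⁻¹' (Set.pi ↑i s) =
        ⋂ f ∈ i, (fun μ : ProbabilityMeasure Z => μ.toFiniteMeasure.testAgainstNN f) ⁻¹' s f := by
      ext μ; simp
    rw [this]
    refine Finset.measurableSet_biInter i fun f hf => ?_
    refine measurableSet_preimage ?_ (hs f hf).measurableSet
    refine ENNReal.measurable_toNNReal.comp ?_
    exact (Measure.measurable_lintegral (f.continuous.measurable.coe_nnreal_ennreal)).comp
      measurable_subtype_coe

end WeakTopology

/-! ### Optimal transport on compact metrizable spaces. -/

/-- The optimal transport cost between two measures. -/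
noncomputable def otCost {E F : Type*} [MeasurableSpace E] [MeasurableSpace F]
    (c : E × F → ℝ≥0∞) (μ : Measure E) (ν : Measure F) : ℝ≥0∞ :=
  ⨅ π ∈ {π : Measure (E × F) | π.fst = μ ∧ π.snd = ν}, ∫⁻ p, c p ∂π

section OtCost

variable {E F : Type*} [MeasurableSpace E] [MeasurableSpace F] {c : E × F → ℝ≥0∞}
  {μ : Measure E} {ν : Measure F}

lemma otCost_le {π : Measure (E × F)} (h1 : π.fst = μ) (h2 : π.snd = ν) :
    otCost c μ ν ≤ ∫⁻ p, c p ∂π :=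
  iInf₂_le (f := fun (π : Measure (E × F)) (_ : π ∈ {π | π.fst = μ ∧ π.snd = ν}) =>
    ∫⁻ p, c p ∂π) π ⟨h1, h2⟩

lemma le_otCost {a : ℝ≥0∞}
    (h : ∀ π : Measure (E × F), π.fst = μ → π.snd = ν → a ≤ ∫⁻ p, c p ∂π) :
    a ≤ otCost c μ ν :=
  le_iInf₂ fun π hπ => h π hπ.1 hπ.2

end OtCost

section Compact

variable {Z W : Type*}
  [TopologicalSpace Z] [CompactSpace Z] [MetrizableSpace Z] [MeasurableSpace Z] [BorelSpace Z]
  [TopologicalSpace W] [CompactSpace W] [MetrizableSpace W] [MeasurableSpace W] [BorelSpace W]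

lemma secondCountableTopology_of_compact_metrizable (Z : Type*) [TopologicalSpace Z]
    [CompactSpace Z] [MetrizableSpace Z] : SecondCountableTopology Z := by
  let := metrizableSpaceMetric Z
  infer_instance

/-- On compact metrizable spaces and for a lower semicontinuous cost, the optimal transport cost
is lower semicontinuous in the marginals, and optimal couplings can be selected measurably. -/
theorem lowerSemicontinuous_otCost_and_exists_measurable_optimal {C : Z × W → ℝ≥0∞}
    (hC : LowerSemicontinuous C) :
    (LowerSemicontinuous fun y : ProbabilityMeasure Z × ProbabilityMeasure W =>
      otCost C y.1 y.2) ∧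
    ∃ σ : ProbabilityMeasure Z × ProbabilityMeasure W → ProbabilityMeasure (Z × W),
      Measurable σ ∧ ∀ y, (σ y : Measure (Z × W)).fst = y.1 ∧ (σ y : Measure (Z × W)).snd = y.2 ∧
        ∫⁻ p, C p ∂(σ y : Measure (Z × W)) = otCost C y.1 y.2 := by
  have := secondCountableTopology_of_compact_metrizable Z
  have := secondCountableTopology_of_compact_metrizable W
  have := secondCountableTopology_of_compact_metrizable (ProbabilityMeasure Z)
  have := secondCountableTopology_of_compact_metrizable (ProbabilityMeasure W)
  let G : Set ((ProbabilityMeasure Z × ProbabilityMeasure W) × ProbabilityMeasure (Z × W)) :=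
    {q | q.2.map measurable_fst.aemeasurable = q.1.1 ∧
      q.2.map measurable_snd.aemeasurable = q.1.2}
  have hG : IsClosed G :=
    (isClosed_eq ((ProbabilityMeasure.continuous_map continuous_fst).comp continuous_snd)
      (continuous_fst.comp continuous_fst)).inter
    (isClosed_eq ((ProbabilityMeasure.continuous_map continuous_snd).comp continuous_snd)
      (continuous_snd.comp continuous_fst))
  have hGiff : ∀ y γ, (y, γ) ∈ G ↔
      (γ : Measure (Z × W)).fst = y.1 ∧ (γ : Measure (Z × W)).snd = y.2 := by
    intro y γ
    constructor
    · rintro ⟨h1, h2⟩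
      exact ⟨congrArg ProbabilityMeasure.toMeasure h1, congrArg ProbabilityMeasure.toMeasure h2⟩
    · rintro ⟨h1, h2⟩
      exact ⟨Subtype.ext h1, Subtype.ext h2⟩
  have hne : ∀ y, ∃ γ, (y, γ) ∈ G := fun y => ⟨y.1.prod y.2,
    ProbabilityMeasure.map_fst_prod _ _, ProbabilityMeasure.map_snd_prod _ _⟩
  have hh := lowerSemicontinuous_lintegral hC
  have hcost : ∀ y : ProbabilityMeasure Z × ProbabilityMeasure W, otCost C y.1 y.2 =
      ⨅ γ ∈ {γ | (y, γ) ∈ G}, ∫⁻ p, C p ∂(γ : Measure (Z × W)) := by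
    intro y
    apply le_antisymm
    · refine le_iInf₂ fun γ hγ => ?_
      exact otCost_le ((hGiff y γ).1 hγ).1 ((hGiff y γ).1 hγ).2
    · refine le_otCost fun π h1 h2 => ?_
      -- `otCost` ranges over arbitrary measures; the total mass is read off from the first
      -- marginal.
      have hπ : IsProbabilityMeasure π := ⟨by rw [← Measure.fst_univ, h1, measure_univ]⟩
      exact iInf₂_le (f := fun γ (_ : γ ∈ {γ | (y, γ) ∈ G}) => ∫⁻ p, C p ∂(γ : Measure (Z × W)))
        (⟨π, hπ⟩ : ProbabilityMeasure (Z × W)) ((hGiff y _).2 ⟨h1, h2⟩)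
  constructor
  · simp_rw [hcost]
    exact lowerSemicontinuous_iInf_section hG hh hne
  · obtain ⟨σ, hσm, hσ⟩ := exists_measurable_argmin hG hh hne
    refine ⟨σ, hσm, fun y => ⟨((hGiff y _).1 (hσ y).1).1, ((hGiff y _).1 (hσ y).1).2, ?_⟩⟩
    rw [hcost]
    exact le_antisymm (le_iInf₂ fun γ hγ => (hσ y).2 γ hγ)
      (iInf₂_le (f := fun γ (_ : γ ∈ {γ | (y, γ) ∈ G}) => ∫⁻ p, C p ∂(γ : Measure (Z × W)))
        (σ y) (hσ y).1)

end Compact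

/-! ### Encodable cost functions. -/

/-- A cost function is lower semicontinuously encodable if it becomes a lower semicontinuous
function on a product of compact metrizable spaces after a measurable recoding of each
variable. -/
def LscEncodable {S S' : Type*} [MeasurableSpace S] [MeasurableSpace S']
    (V : S → S' → ℝ≥0∞) : Prop :=
  ∃ (Z : Type) (_ : TopologicalSpace Z) (_ : CompactSpace Z) (_ : MetrizableSpace Z)
    (_ : MeasurableSpace Z) (_ : BorelSpace Z)
    (W : Type) (_ : TopologicalSpace W) (_ : CompactSpace W) (_ : MetrizableSpace W)
    (_ : MeasurableSpace W) (_ : BorelSpace W)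
    (z : S → Z) (w : S' → W) (C : Z × W → ℝ≥0∞),
    Measurable z ∧ Measurable w ∧ LowerSemicontinuous C ∧ ∀ a b, V a b = C (z a, w b)

namespace LscEncodable

variable {S S' R R' : Type*} [MeasurableSpace S] [MeasurableSpace S']
  [MeasurableSpace R] [MeasurableSpace R'] {V U : S → S' → ℝ≥0∞}

lemma zero : LscEncodable fun (_ : S) (_ : S') => (0 : ℝ≥0∞) :=
  ⟨unitInterval, inferInstance, inferInstance, inferInstance, inferInstance, inferInstance,
    unitInterval, inferInstance, inferInstance, inferInstance, inferInstance, inferInstance,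
    fun _ => 0, fun _ => 0, fun _ => 0, measurable_const, measurable_const,
    lowerSemicontinuous_const, fun _ _ => rfl⟩

lemma comp (hV : LscEncodable V) {f : R → S} {g : R' → S'} (hf : Measurable f)
    (hg : Measurable g) : LscEncodable fun a b => V (f a) (g b) := by
  obtain ⟨Z, _, _, _, _, _, W, _, _, _, _, _, z, w, C, hz, hw, hC, h⟩ := hV
  exact ⟨Z, inferInstance, inferInstance, inferInstance, inferInstance, inferInstance,
    W, inferInstance, inferInstance, inferInstance, inferInstance, inferInstance, z ∘ f, w ∘ g, C,
    hz.comp hf, hw.comp hg, hC, fun a b => h _ _⟩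

lemma add (hV : LscEncodable V) (hU : LscEncodable U) :
    LscEncodable fun a b => V a b + U a b := by
  obtain ⟨Z, _, _, _, _, _, W, _, _, _, _, _, z, w, C, hz, hw, hC, h⟩ := hV
  obtain ⟨Z', _, _, _, _, _, W', _, _, _, _, _, z', w', C', hz', hw', hC', h'⟩ := hU
  have := secondCountableTopology_of_compact_metrizable Z
  have := secondCountableTopology_of_compact_metrizable Z'
  have := secondCountableTopology_of_compact_metrizable W
  have := secondCountableTopology_of_compact_metrizable W'
  refine ⟨Z × Z', inferInstance, inferInstance, inferInstance, inferInstance, inferInstance,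
    W × W', inferInstance, inferInstance, inferInstance, inferInstance, inferInstance,
    fun a => (z a, z' a), fun b => (w b, w' b),
    fun p => C (p.1.1, p.2.1) + C' (p.1.2, p.2.2), hz.prodMk hz', hw.prodMk hw', ?_,
    fun a b => by simp only [h, h']⟩
  exact (hC.comp (by fun_prop)).add (hC'.comp (by fun_prop))

lemma measurable (hV : LscEncodable V) : Measurable fun p : S × S' => V p.1 p.2 := by
  obtain ⟨Z, _, _, _, _, _, W, _, _, _, _, _, z, w, C, hz, hw, hC, h⟩ := hV
  have := secondCountableTopology_of_compact_metrizable Z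
  have := secondCountableTopology_of_compact_metrizable W
  simp_rw [h]
  exact hC.measurable.comp (by fun_prop)

/-- A lower semicontinuous function on a product of separable metrizable spaces is encodable: embed
both factors in the Hilbert cube and take the lower semicontinuous hull. -/
lemma of_lowerSemicontinuous {X : Type*} [MetricSpace X] [SeparableSpace X]
    [MeasurableSpace X] [BorelSpace X] {c : X × X → ℝ≥0∞} (hc : LowerSemicontinuous c) :
    LscEncodable fun x y => c (x, y) := by
  obtain ⟨ι, hι⟩ := Metric.PiNatEmbed.exists_embedding_to_hilbert_cube (X := X)
  have hιι := hι.prodMap hι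
  -- Away from the closure of the image the traced filter is trivial and the liminf is `∞`; on the
  -- image it is the neighbourhood filter of the original point.
  let C : (ℕ → unitInterval) × (ℕ → unitInterval) → ℝ≥0∞ := fun k =>
    (comap (Prod.map ι ι) (𝓝 k)).liminf c
  refine ⟨ℕ → unitInterval, inferInstance, inferInstance, inferInstance, inferInstance,
    inferInstance, ℕ → unitInterval, inferInstance, inferInstance, inferInstance, inferInstance,
    inferInstance, ι, ι, C, hι.continuous.measurable, hι.continuous.measurable, ?_, ?_⟩
  · intro k a ha
    obtain ⟨b, hab, hb⟩ := exists_between ha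
    have h1 : ∀ᶠ p in comap (Prod.map ι ι) (𝓝 k), b < c p :=
      eventually_lt_of_lt_liminf hb
    obtain ⟨U, hU, hUs⟩ := mem_comap.1 h1
    filter_upwards [eventually_mem_nhds_iff.2 hU] with k' hk'
    refine hab.trans_le (le_liminf_of_le (by isBoundedDefault) ?_)
    exact mem_comap.2 ⟨U, hk', fun p hp => le_of_lt (show b < c p from hUs hp)⟩
  · intro x y
    have : comap (Prod.map ι ι) (𝓝 (ι x, ι y)) = 𝓝 (x, y) :=
      (hιι.isInducing.nhds_eq_comap (x, y)).symm
    simp only [C, this]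
    exact le_antisymm (lowerSemicontinuous_iff_le_liminf.1 hc (x, y))
      ((liminf_le_of_frequently_le'
        (frequently_iff.2 fun hU => ⟨(x, y), mem_of_mem_nhds hU, le_rfl⟩)))

end LscEncodable

/-! ### Transport under recoding, and one dynamic programming step. -/

section Coding

variable {E F Z W : Type*} [MeasurableSpace E] [MeasurableSpace F] [MeasurableSpace Z]
  [MeasurableSpace W]

lemma fst_map_prodMap {π : Measure (E × F)} {f : E → Z} {g : F → W} (hf : Measurable f)
    (hg : Measurable g) : (π.map (Prod.map f g)).fst = π.fst.map f := by
  rw [Measure.fst, Measure.fst, Measure.map_map measurable_fst (hf.prodMap hg),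
    Measure.map_map hf measurable_fst]
  rfl

lemma snd_map_prodMap {π : Measure (E × F)} {f : E → Z} {g : F → W} (hf : Measurable f)
    (hg : Measurable g) : (π.map (Prod.map f g)).snd = π.snd.map g := by
  rw [Measure.snd, Measure.snd, Measure.map_map measurable_snd (hf.prodMap hg),
    Measure.map_map hg measurable_snd]
  rfl

variable {c : E × F → ℝ≥0∞} {C : Z × W → ℝ≥0∞} {f : E → Z} {g : F → W} {f' : Z → E} {g' : W → F}
  {μ : Measure E} {ν : Measure F}

/-- Optimal transport is invariant under injective recoding of the two spaces: pulling back a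
coupling of the image measures. -/
lemma coupling_decode (hf : Measurable f) (hg : Measurable g) (hf' : Measurable f')
    (hg' : Measurable g') (hff' : Function.LeftInverse f' f) (hgg' : Function.LeftInverse g' g)
    (hZ : MeasurableSet {z | f (f' z) = z}) (hW : MeasurableSet {w | g (g' w) = w})
    (hC : Measurable C) (hc : ∀ p, c p = C (Prod.map f g p))
    {γ : Measure (Z × W)} (h1 : γ.fst = μ.map f) (h2 : γ.snd = ν.map g) :
    (γ.map (Prod.map f' g')).fst = μ ∧ (γ.map (Prod.map f' g')).snd = ν ∧
      ∫⁻ p, c p ∂(γ.map (Prod.map f' g')) = ∫⁻ q, C q ∂γ := by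
  refine ⟨?_, ?_, ?_⟩
  · rw [fst_map_prodMap hf' hg', h1, Measure.map_map hf' hf, hff'.comp_eq_id, Measure.map_id]
  · rw [snd_map_prodMap hf' hg', h2, Measure.map_map hg' hg, hgg'.comp_eq_id, Measure.map_id]
  · have hcm : Measurable c := by
      rw [show c = C ∘ Prod.map f g from funext hc]
      exact hC.comp (hf.prodMap hg)
    rw [lintegral_map hcm (hf'.prodMap hg')]
    -- The marginals of `γ` are image measures, so `γ` lives on the ranges of `f` and `g`, where
    -- encoding undoes decoding.
    have hz : ∀ᵐ z ∂γ.fst, f (f' z) = z := by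
      rw [h1, ae_map_iff hf.aemeasurable hZ]
      exact ae_of_all _ fun x => by rw [hff']
    have hw : ∀ᵐ w ∂γ.snd, g (g' w) = w := by
      rw [h2, ae_map_iff hg.aemeasurable hW]
      exact ae_of_all _ fun x => by rw [hgg']
    refine lintegral_congr_ae ?_
    filter_upwards [ae_of_ae_map measurable_fst.aemeasurable hz,
      ae_of_ae_map measurable_snd.aemeasurable hw] with q hq1 hq2
    rw [hc]
    exact congrArg C (Prod.ext hq1 hq2)

/-- Couplings are pushed forward in one direction and decoded by `coupling_decode` in the other,
both without change of cost. -/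
lemma otCost_map (hf : Measurable f) (hg : Measurable g) (hf' : Measurable f')
    (hg' : Measurable g') (hff' : Function.LeftInverse f' f) (hgg' : Function.LeftInverse g' g)
    (hZ : MeasurableSet {z | f (f' z) = z}) (hW : MeasurableSet {w | g (g' w) = w})
    (hC : Measurable C) (hc : ∀ p, c p = C (Prod.map f g p)) :
    otCost c μ ν = otCost C (μ.map f) (ν.map g) := by
  apply le_antisymm
  · refine le_otCost fun γ h1 h2 => ?_
    obtain ⟨h3, h4, h5⟩ := coupling_decode hf hg hf' hg' hff' hgg' hZ hW hC hc h1 h2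
    exact h5 ▸ otCost_le h3 h4
  · refine le_otCost fun π h1 h2 => ?_
    refine (otCost_le (π := π.map (Prod.map f g)) ?_ ?_).trans_eq ?_
    · rw [fst_map_prodMap hf hg, h1]
    · rw [snd_map_prodMap hf hg, h2]
    · rw [lintegral_map hC (hf.prodMap hg)]
      exact lintegral_congr fun p => (hc p).symm

end Coding

/-- One step of dynamic programming: if the terminal cost is lower semicontinuously encodable then
so is the optimal transport cost between the values of two kernels, and optimal couplings may be
chosen to form a kernel. -/
theorem LscEncodable.otCost {S S' E F : Type*} [MeasurableSpace S] [MeasurableSpace S']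
    [MeasurableSpace E] [MeasurableSpace F] [StandardBorelSpace E] [StandardBorelSpace F]
    [Nonempty E] [Nonempty F] {V : S × E → S' × F → ℝ≥0∞} (hV : LscEncodable V)
    (K : Kernel S E) (L : Kernel S' F) [IsMarkovKernel K] [IsMarkovKernel L] :
    (LscEncodable fun s s' => otCost (fun p => V (s, p.1) (s', p.2)) (K s) (L s')) ∧
    ∃ Q : Kernel (S × S') (E × F), IsMarkovKernel Q ∧ ∀ s s',
      (Q (s, s')).fst = K s ∧ (Q (s, s')).snd = L s' ∧
      ∫⁻ p, V (s, p.1) (s', p.2) ∂(Q (s, s')) =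
        NestedOT.otCost (fun p => V (s, p.1) (s', p.2)) (K s) (L s') := by
  obtain ⟨Z, _, _, _, _, _, W, _, _, _, _, _, z, w, C, hz, hw, hC, h⟩ := hV
  have := secondCountableTopology_of_compact_metrizable Z
  have := secondCountableTopology_of_compact_metrizable W
  have hi := measurableEmbedding_sigmoid_comp_embeddingReal E
  have hj := measurableEmbedding_sigmoid_comp_embeddingReal F
  set i := unitInterval.sigmoid ∘ MeasureTheory.embeddingReal E
  set j := unitInterval.sigmoid ∘ MeasureTheory.embeddingReal F
  -- The extra coordinate `i x` makes every `f s` injective, with a decoder `f'` that does not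
  -- depend on `s`; the cost `C'` ignores this coordinate.
  let f : S → E → Z × unitInterval := fun s x => (z (s, x), i x)
  let g : S' → F → W × unitInterval := fun s x => (w (s, x), j x)
  let f' : Z × unitInterval → E := fun q => hi.invFun q.2
  let g' : W × unitInterval → F := fun q => hj.invFun q.2
  let C' : (Z × unitInterval) × (W × unitInterval) → ℝ≥0∞ := fun q => C (q.1.1, q.2.1)
  have hC' : LowerSemicontinuous C' := hC.comp (by fun_prop)
  have hf2 : Measurable fun p : S × E => f p.1 p.2 :=
    hz.prodMk (hi.measurable.comp measurable_snd)
  have hg2 : Measurable fun p : S' × F => g p.1 p.2 :=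
    hw.prodMk (hj.measurable.comp measurable_snd)
  have hf : ∀ s, Measurable (f s) := fun s => hf2.comp measurable_prodMk_left
  have hg : ∀ s, Measurable (g s) := fun s => hg2.comp measurable_prodMk_left
  have hf' : Measurable f' := hi.measurable_invFun.comp measurable_snd
  have hg' : Measurable g' := hj.measurable_invFun.comp measurable_snd
  have hff' : ∀ s, Function.LeftInverse f' (f s) := fun s x => hi.leftInverse_invFun x
  have hgg' : ∀ s, Function.LeftInverse g' (g s) := fun s x => hj.leftInverse_invFun x
  have hZ : ∀ s, MeasurableSet {q | f s (f' q) = q} := fun s =>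
    measurableSet_eq_fun ((hf s).comp hf') measurable_id
  have hW : ∀ s, MeasurableSet {q | g s (g' q) = q} := fun s =>
    measurableSet_eq_fun ((hg s).comp hg') measurable_id
  have hc : ∀ s s' p, V (s, p.1) (s', p.2) = C' (Prod.map (f s) (g s') p) := fun s s' p => h _ _
  -- The new code of a state: the law of the code of its successor.
  let P : S → ProbabilityMeasure (Z × unitInterval) := fun s =>
    ⟨(K s).map (f s), Measure.isProbabilityMeasure_map (hf s).aemeasurable⟩
  let R : S' → ProbabilityMeasure (W × unitInterval) := fun s =>
    ⟨(L s).map (g s), Measure.isProbabilityMeasure_map (hg s).aemeasurable⟩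
  have hP : Measurable P := by
    refine Measurable.subtype_mk (Measure.measurable_of_measurable_coe _ fun A hA => ?_)
    simp_rw [Measure.map_apply (hf _) hA]
    exact Kernel.measurable_kernel_prodMk_left (hf2 hA)
  have hR : Measurable R := by
    refine Measurable.subtype_mk (Measure.measurable_of_measurable_coe _ fun A hA => ?_)
    simp_rw [Measure.map_apply (hg _) hA]
    exact Kernel.measurable_kernel_prodMk_left (hg2 hA)
  obtain ⟨hlsc, σ, hσm, hσ⟩ := lowerSemicontinuous_otCost_and_exists_measurable_optimal hC'
  have hcost : ∀ s s', NestedOT.otCost (fun p => V (s, p.1) (s', p.2)) (K s) (L s') =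
      NestedOT.otCost C' (P s) (R s') := fun s s' =>
    otCost_map (hf s) (hg s') hf' hg' (hff' s) (hgg' s') (hZ s) (hW s') hC'.measurable (hc s s')
  constructor
  · exact ⟨ProbabilityMeasure (Z × unitInterval), inferInstance, inferInstance, inferInstance,
      inferInstance, inferInstance, ProbabilityMeasure (W × unitInterval), inferInstance,
      inferInstance, inferInstance, inferInstance, inferInstance, P, R,
      fun y => NestedOT.otCost C' y.1 y.2, hP, hR, hlsc, hcost⟩
  · have hdec : ∀ s s', _ := fun s s' => coupling_decode (hf s) (hg s') hf' hg' (hff' s)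
      (hgg' s') (hZ s) (hW s') hC'.measurable (hc s s') (hσ (P s, R s')).1 (hσ (P s, R s')).2.1
    have hm : Measurable fun p : S × S' =>
        (σ (P p.1, R p.2) : Measure ((Z × unitInterval) × (W × unitInterval))) :=
      measurable_subtype_coe.comp
        (hσm.comp ((hP.comp measurable_fst).prodMk (hR.comp measurable_snd)))
    have hm' := (Measure.measurable_map _ (hf'.prodMap hg')).comp hm
    -- The measurably selected optimal coupling of the codes, decoded.
    let Q : Kernel (S × S') (E × F) := ⟨_, hm'⟩
    refine ⟨Q, ⟨fun p => Measure.isProbabilityMeasure_map (hf'.prodMap hg').aemeasurable⟩,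
      fun s s' => ⟨(hdec s s').1, (hdec s s').2.1, ?_⟩⟩
    rw [hcost]
    exact (hdec s s').2.2.trans (hσ (P s, R s')).2.2

end NestedOT

/-! ### Paths, pasts and conditional kernels. -/

namespace NestedOT

variable {d T : ℕ}

lemma measurable_future (t : ℕ) : Measurable (future t : PathSpace d T → PathSpace d (T - t)) :=
  measurable_pi_lambda _ fun _ => measurable_pi_apply _

/-- `(x_{1:t}, x_{t+1}) ↦ x_{1:t+1}`. -/
def snoc {t : ℕ} (p : PathSpace d t × PathSpace d 1) : PathSpace d (t + 1) := Fin.append p.1 p.2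

/-- `snoc` on both components of a pair of paths. -/
def snocPair {t : ℕ} (p : (PathSpace d t × PathSpace d t) × (PathSpace d 1 × PathSpace d 1)) :
    PathSpace d (t + 1) × PathSpace d (t + 1) :=
  (snoc (p.1.1, p.2.1), snoc (p.1.2, p.2.2))

lemma measurable_append (s t : ℕ) :
    Measurable fun p : PathSpace d s × PathSpace d t =>
      (Fin.append p.1 p.2 : PathSpace d (s + t)) := by
  refine measurable_pi_lambda _ fun i => ?_
  induction i using Fin.addCases with
  | left i => simp only [Fin.append_left]; fun_prop
  | right i => simp only [Fin.append_right]; fun_prop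

lemma measurable_snoc {t : ℕ} : Measurable (snoc : PathSpace d t × PathSpace d 1 → _) :=
  measurable_append t 1

lemma measurable_snocPair {t : ℕ} : Measurable
    (snocPair : (PathSpace d t × PathSpace d t) × (PathSpace d 1 × PathSpace d 1) → _) :=
  (measurable_snoc.comp (by fun_prop)).prodMk (measurable_snoc.comp (by fun_prop))

lemma snoc_past_future {t : ℕ} (ht : t < T) (x : PathSpace d T) :
    snoc (past t ht.le x, past 1 (by omega) (future t x)) = past (t + 1) ht x := by
  funext i
  induction i using Fin.addCases with
  | left i => simp [snoc, past]; rfl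
  | right i =>
    simp only [snoc, Fin.append_right, past, future]
    exact congrArg x (Fin.ext rfl)

lemma past_snoc {s t : ℕ} (hs : s ≤ t) (x : PathSpace d t) (e : PathSpace d 1) :
    past s (hs.trans t.le_succ) (snoc (x, e)) = past s hs x := by
  funext i
  have : Fin.castLE (hs.trans t.le_succ) i = Fin.castAdd 1 (Fin.castLE hs i) := rfl
  simp only [past, snoc, this, Fin.append_left]

/-- The kernel of conditional laws of the future given the past. -/
noncomputable def condKernel (μ : ProbabilityMeasure (PathSpace d T)) (t : ℕ) (ht : t ≤ T) :
    Kernel (PathSpace d t) (PathSpace d (T - t)) :=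
  condDistrib (future t) (past t ht) (μ : Measure (PathSpace d T))

instance (μ : ProbabilityMeasure (PathSpace d T)) (t : ℕ) (ht : t ≤ T) :
    IsMarkovKernel (condKernel μ t ht) := by unfold condKernel; infer_instance

/-- The kernel of one-step conditional laws. -/
noncomputable def nextKernel (μ : ProbabilityMeasure (PathSpace d T)) (t : ℕ) (ht : t < T) :
    Kernel (PathSpace d t) (PathSpace d 1) :=
  (condKernel μ t ht.le).map (past 1 (by omega))

instance (μ : ProbabilityMeasure (PathSpace d T)) (t : ℕ) (ht : t < T) :
    IsMarkovKernel (nextKernel μ t ht) := Kernel.IsMarkovKernel.map _ (measurable_past _ _)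

lemma coe_condLaw (μ : ProbabilityMeasure (PathSpace d T)) (t : ℕ) (ht : t ≤ T)
    (x : PathSpace d t) : (condLaw μ t ht x : Measure _) = condKernel μ t ht x := rfl

lemma coe_nextLaw (μ : ProbabilityMeasure (PathSpace d T)) (t : ℕ) (ht : t < T)
    (x : PathSpace d t) : (nextLaw μ t ht x : Measure _) = nextKernel μ t ht x := by
  rw [nextKernel, Kernel.map_apply _ (measurable_past _ _)]
  rfl

lemma coe_pastLaw (μ : ProbabilityMeasure (PathSpace d T)) (t : ℕ) (ht : t ≤ T) :
    (pastLaw μ t ht : Measure _) = (μ : Measure (PathSpace d T)).map (past t ht) := rfl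

lemma pastLaw_compProd_condKernel (μ : ProbabilityMeasure (PathSpace d T)) (t : ℕ) (ht : t ≤ T) :
    (pastLaw μ t ht : Measure _) ⊗ₘ condKernel μ t ht =
      (μ : Measure (PathSpace d T)).map fun x => (past t ht x, future t x) :=
  compProd_map_condDistrib (measurable_future t).aemeasurable

lemma pastLaw_compProd_nextKernel (μ : ProbabilityMeasure (PathSpace d T)) (t : ℕ) (ht : t < T) :
    (pastLaw μ t ht.le : Measure _) ⊗ₘ nextKernel μ t ht =
      (μ : Measure (PathSpace d T)).map fun x =>
        (past t ht.le x, past 1 (by omega) (future t x)) := by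
  rw [nextKernel, Measure.compProd_map (measurable_past _ _), pastLaw_compProd_condKernel,
    Measure.map_map (measurable_id.prodMap (measurable_past _ _))
      ((measurable_past _ _).prodMk (measurable_future _))]
  rfl

lemma pastLaw_succ (μ : ProbabilityMeasure (PathSpace d T)) (t : ℕ) (ht : t < T) :
    (pastLaw μ (t + 1) ht : Measure _) =
      ((pastLaw μ t ht.le : Measure _) ⊗ₘ nextKernel μ t ht).map snoc := by
  have hm : Measurable fun x : PathSpace d T =>
      (past t ht.le x, past 1 (by omega : 1 ≤ T - t) (future t x)) :=
    (measurable_past _ _).prodMk ((measurable_past _ _).comp (measurable_future _))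
  rw [pastLaw_compProd_nextKernel, Measure.map_map measurable_snoc hm, coe_pastLaw]
  exact congrArg (fun f => Measure.map f (μ : Measure (PathSpace d T)))
    (funext fun x => (snoc_past_future ht x).symm)

section Pair

variable (π : ProbabilityMeasure (PathSpace d T × PathSpace d T)) (t : ℕ)

/-- The kernel of conditional laws of the future of a pair of paths given its past. -/
noncomputable def pairCondKernel (ht : t ≤ T) :
    Kernel (PathSpace d t × PathSpace d t) (PathSpace d (T - t) × PathSpace d (T - t)) :=
  condDistrib (Prod.map (future t) (future t)) (Prod.map (past t ht) (past t ht))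
    (π : Measure (PathSpace d T × PathSpace d T))

instance (ht : t ≤ T) : IsMarkovKernel (pairCondKernel π t ht) := by
  unfold pairCondKernel; infer_instance

/-- The kernel of one-step conditional laws of a pair of paths. -/
noncomputable def pairNextKernel (ht : t < T) :
    Kernel (PathSpace d t × PathSpace d t) (PathSpace d 1 × PathSpace d 1) :=
  (pairCondKernel π t ht.le).map (Prod.map (past 1 (by omega)) (past 1 (by omega)))

instance (ht : t < T) : IsMarkovKernel (pairNextKernel π t ht) :=
  Kernel.IsMarkovKernel.map _ ((measurable_past _ _).prodMap (measurable_past _ _))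

lemma coe_pairCondLaw (ht : t ≤ T) (p : PathSpace d t × PathSpace d t) :
    (pairCondLaw π t ht p : Measure _) = pairCondKernel π t ht p := rfl

lemma coe_pairPastLaw (ht : t ≤ T) :
    (pairPastLaw π t ht : Measure _) =
      (π : Measure (PathSpace d T × PathSpace d T)).map (Prod.map (past t ht) (past t ht)) := rfl

lemma pairPastLaw_compProd_pairCondKernel (ht : t ≤ T) :
    (pairPastLaw π t ht : Measure _) ⊗ₘ pairCondKernel π t ht =
      (π : Measure (PathSpace d T × PathSpace d T)).map fun p =>
      (Prod.map (past t ht) (past t ht) p, Prod.map (future t) (future t) p) :=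
  compProd_map_condDistrib ((measurable_future t).prodMap (measurable_future t)).aemeasurable

lemma pairPastLaw_succ (ht : t < T) :
    (pairPastLaw π (t + 1) ht : Measure _) =
      ((pairPastLaw π t ht.le : Measure _) ⊗ₘ pairNextKernel π t ht).map snocPair := by
  have hp1 : Measurable (Prod.map (past 1 (by omega)) (past 1 (by omega)) :
      PathSpace d (T - t) × PathSpace d (T - t) → PathSpace d 1 × PathSpace d 1) :=
    (measurable_past _ _).prodMap (measurable_past _ _)
  have hpf : Measurable fun p : PathSpace d T × PathSpace d T =>
      (Prod.map (past t ht.le) (past t ht.le) p, Prod.map (future t) (future t) p) :=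
    ((measurable_past _ _).prodMap (measurable_past _ _)).prodMk
      ((measurable_future _).prodMap (measurable_future _))
  rw [pairNextKernel, Measure.compProd_map hp1, pairPastLaw_compProd_pairCondKernel,
    Measure.map_map (measurable_id.prodMap hp1) hpf,
    Measure.map_map measurable_snocPair ((measurable_id.prodMap hp1).comp hpf), coe_pairPastLaw]
  refine congrArg (fun f => Measure.map f (π : Measure (PathSpace d T × PathSpace d T)))
    (funext fun p => ?_)
  exact Prod.ext (snoc_past_future ht p.1).symm (snoc_past_future ht p.2).symm

end Pair

/-! ### One-step couplings and regularity of the value functions. -/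

lemma mem_Cpl_iff {μ ν : ProbabilityMeasure (PathSpace d T)}
    {π : ProbabilityMeasure (PathSpace d T × PathSpace d T)} :
    π ∈ Cpl μ ν ↔ (π : Measure (PathSpace d T × PathSpace d T)).fst =
      (μ : Measure (PathSpace d T)) ∧
      (π : Measure (PathSpace d T × PathSpace d T)).snd = (ν : Measure (PathSpace d T)) := by
  constructor
  · rintro ⟨h1, h2⟩
    exact ⟨congrArg ProbabilityMeasure.toMeasure h1, congrArg ProbabilityMeasure.toMeasure h2⟩
  · rintro ⟨h1, h2⟩
    exact ⟨Subtype.ext h1, Subtype.ext h2⟩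

/-- The law of `X` is a Dirac mass, so averaging the conditional law over it evaluates it at the
only point. No null set is left to choose at time zero. -/
lemma condDistrib_of_subsingleton {Ω α β : Type*} [MeasurableSpace Ω] [MeasurableSpace α]
    [MeasurableSpace β] [StandardBorelSpace β] [Nonempty β] [Subsingleton α] {X : Ω → α}
    {Y : Ω → β} (hX : Measurable X) (hY : Measurable Y) (P : Measure Ω) [IsProbabilityMeasure P]
    (a : α) : condDistrib Y X P a = P.map Y := by
  have hd : P.map X = Measure.dirac a := by
    have := Measure.isProbabilityMeasure_map (μ := P) hX.aemeasurable
    ext s hs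
    rcases s.eq_empty_or_nonempty with rfl | ⟨b, hb⟩
    · simp
    · obtain rfl := Subsingleton.eq_univ_of_nonempty ⟨b, hb⟩
      simp
  have h := congrArg Measure.snd (compProd_map_condDistrib (X := X) (μ := P) hY.aemeasurable)
  rw [Measure.snd_compProd, hd, Measure.dirac_bind (Kernel.measurable _),
    Measure.snd_map_prodMk hX] at h
  exact h

/-- With a single step only `t = 0` is constrained, and conditioning on an empty past changes
nothing. -/
lemma mem_CplBC_one_iff {μ ν : ProbabilityMeasure (PathSpace d 1)}
    {π : ProbabilityMeasure (PathSpace d 1 × PathSpace d 1)} :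
    π ∈ CplBC μ ν ↔ π ∈ Cpl μ ν := by
  refine ⟨fun h => h.1, fun h => ⟨h, fun t ht => ?_⟩⟩
  obtain rfl : t = 0 := by omega
  refine Filter.Eventually.of_forall fun p => mem_Cpl_iff.2 ?_
  obtain ⟨h1, h2⟩ := mem_Cpl_iff.1 h
  rw [coe_pairCondLaw, coe_condLaw, coe_condLaw, pairCondKernel, condKernel, condKernel,
    condDistrib_of_subsingleton (measurable_past _ _) (measurable_future _),
    condDistrib_of_subsingleton (measurable_past _ _) (measurable_future _),
    condDistrib_of_subsingleton ((measurable_past _ _).prodMap (measurable_past _ _))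
      ((measurable_future _).prodMap (measurable_future _)),
    fst_map_prodMap (measurable_future _) (measurable_future _),
    snd_map_prodMap (measurable_future _) (measurable_future _), h1, h2]
  exact ⟨rfl, rfl⟩

/-- One-step bi-causality being vacuous, the recursion is a plain transport problem between two
kernels, the form required by `LscEncodable.otCost`. -/
lemma valueFn_of_lt (μ ν : ProbabilityMeasure (PathSpace d T)) (t : ℕ) (ht : t < T)
    (x y : PathSpace d t) :
    valueFn μ ν t x y = otCost (fun p : PathSpace d 1 × PathSpace d 1 => ‖p.1 0 - p.2 0‖ₑ ^ 2 +
      valueFn μ ν (t + 1) (snoc (x, p.1)) (snoc (y, p.2)))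
      (nextKernel μ t ht x) (nextKernel ν t ht y) := by
  rw [valueFn, dif_pos ht]
  apply le_antisymm
  · refine le_otCost fun π h1 h2 => ?_
    have hπ : IsProbabilityMeasure π := ⟨by rw [← Measure.fst_univ, h1, measure_univ]⟩
    refine iInf₂_le (⟨π, hπ⟩ : ProbabilityMeasure (PathSpace d 1 × PathSpace d 1)) ?_
    refine mem_CplBC_one_iff.2 (mem_Cpl_iff.2 ?_)
    rw [coe_nextLaw, coe_nextLaw]
    exact ⟨h1, h2⟩
  · refine le_iInf₂ fun π hπ => ?_
    rw [mem_CplBC_one_iff, mem_Cpl_iff, coe_nextLaw, coe_nextLaw] at hπ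
    exact otCost_le hπ.1 hπ.2

lemma valueFn_of_le (μ ν : ProbabilityMeasure (PathSpace d T)) (t : ℕ) (ht : T ≤ t)
    (x y : PathSpace d t) : valueFn μ ν t x y = 0 := by
  rw [valueFn, dif_neg ht.not_gt]

/-- The cost of a transition plus the value of the resulting state is encodable. -/
lemma lscEncodable_stepCost {μ ν : ProbabilityMeasure (PathSpace d T)} {t : ℕ}
    (h : LscEncodable (valueFn μ ν (t + 1))) :
    LscEncodable fun (a b : PathSpace d t × PathSpace d 1) =>
      ‖a.2 0 - b.2 0‖ₑ ^ 2 + valueFn μ ν (t + 1) (snoc a) (snoc b) := by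
  have h1 : LscEncodable fun x y : EuclideanSpace ℝ (Fin d) => ‖x - y‖ₑ ^ 2 :=
    LscEncodable.of_lowerSemicontinuous
      (c := fun p : EuclideanSpace ℝ (Fin d) × EuclideanSpace ℝ (Fin d) => ‖p.1 - p.2‖ₑ ^ 2)
      (Continuous.lowerSemicontinuous (by fun_prop))
  have hm : Measurable fun a : PathSpace d t × PathSpace d 1 => a.2 0 := by fun_prop
  exact (h1.comp hm hm).add (h.comp measurable_snoc measurable_snoc)

/-- Backward induction from the zero function, with one use of `LscEncodable.otCost` per step. -/
lemma lscEncodable_valueFn (μ ν : ProbabilityMeasure (PathSpace d T)) (t : ℕ) :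
    LscEncodable (valueFn μ ν t) := by
  induction hn : T - t generalizing t with
  | zero =>
    have : valueFn μ ν t = fun _ _ => 0 := by
      funext x y
      exact valueFn_of_le μ ν t (by omega) x y
    rw [this]
    exact LscEncodable.zero
  | succ n ih =>
    have ht : t < T := by omega
    have := ((lscEncodable_stepCost (ih (t + 1) (by omega))).otCost
      (nextKernel μ t ht) (nextKernel ν t ht)).1
    have heq : valueFn μ ν t = _ := funext₂ fun x y => valueFn_of_lt μ ν t ht x y
    rw [heq]
    exact this

lemma measurable_valueFn (μ ν : ProbabilityMeasure (PathSpace d T)) (t : ℕ) :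
    Measurable fun p : PathSpace d t × PathSpace d t => valueFn μ ν t p.1 p.2 :=
  (lscEncodable_valueFn μ ν t).measurable

/-- Optimal one-step couplings can be chosen measurably. -/
lemma exists_optimal_kernel (μ ν : ProbabilityMeasure (PathSpace d T)) (t : ℕ) (ht : t < T) :
    ∃ Q : Kernel (PathSpace d t × PathSpace d t) (PathSpace d 1 × PathSpace d 1),
      IsMarkovKernel Q ∧ ∀ p, (Q p).fst = nextKernel μ t ht p.1 ∧
        (Q p).snd = nextKernel ν t ht p.2 ∧
        ∫⁻ q, (‖q.1 0 - q.2 0‖ₑ ^ 2 + valueFn μ ν (t + 1) (snoc (p.1, q.1)) (snoc (p.2, q.2)))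
          ∂(Q p) = valueFn μ ν t p.1 p.2 := by
  obtain ⟨Q, hQ, h⟩ := ((lscEncodable_stepCost (lscEncodable_valueFn μ ν (t + 1))).otCost
    (nextKernel μ t ht) (nextKernel ν t ht)).2
  refine ⟨Q, hQ, fun p => ⟨(h p.1 p.2).1, (h p.1 p.2).2.1, ?_⟩⟩
  rw [valueFn_of_lt μ ν t ht]
  exact (h p.1 p.2).2.2

/-! ### The lower bound: running cost plus value. -/

/-- The squared Euclidean distance of two paths. -/
noncomputable def pathCost {t : ℕ} (p : PathSpace d t × PathSpace d t) : ℝ≥0∞ :=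
  ∑ i, ‖p.1 i - p.2 i‖ₑ ^ 2

lemma measurable_pathCost {t : ℕ} :
    Measurable (pathCost : PathSpace d t × PathSpace d t → ℝ≥0∞) := by
  unfold pathCost; fun_prop

lemma pathCost_snocPair {t : ℕ}
    (p : (PathSpace d t × PathSpace d t) × (PathSpace d 1 × PathSpace d 1)) :
    pathCost (snocPair p) = pathCost p.1 + ‖p.2.1 0 - p.2.2 0‖ₑ ^ 2 := by
  simp only [pathCost, snocPair, snoc, Fin.sum_univ_add, Fin.append_left, Fin.append_right,
    Finset.univ_unique, Fin.default_eq_zero, Finset.sum_singleton]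

/-- The cost of a path splits off its last increment, and the earlier part is constant under the
Markov kernel `Q p`. Both inequalities of the Bellman argument rest on this identity. -/
lemma lintegral_pathCost_add_succ {t : ℕ} (m : Measure (PathSpace d t × PathSpace d t)) [SFinite m]
    (Q : Kernel (PathSpace d t × PathSpace d t) (PathSpace d 1 × PathSpace d 1)) [IsMarkovKernel Q]
    {V : PathSpace d (t + 1) → PathSpace d (t + 1) → ℝ≥0∞}
    (hV : Measurable fun p : PathSpace d (t + 1) × PathSpace d (t + 1) => V p.1 p.2) :
    ∫⁻ p, (pathCost p + V p.1 p.2) ∂((m ⊗ₘ Q).map snocPair) =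
      ∫⁻ p, (pathCost p + ∫⁻ q, (‖q.1 0 - q.2 0‖ₑ ^ 2 +
        V (snoc (p.1, q.1)) (snoc (p.2, q.2))) ∂(Q p)) ∂m := by
  have hW : Measurable fun p : PathSpace d (t + 1) × PathSpace d (t + 1) =>
    pathCost p + V p.1 p.2 := measurable_pathCost.add hV
  have hWs : Measurable fun p : (PathSpace d t × PathSpace d t) ×
      (PathSpace d 1 × PathSpace d 1) => pathCost (snocPair p) + V (snocPair p).1 (snocPair p).2 :=
    hW.comp measurable_snocPair
  rw [lintegral_map hW measurable_snocPair, Measure.lintegral_compProd hWs]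
  refine lintegral_congr fun p => ?_
  simp_rw [pathCost_snocPair, add_assoc]
  rw [lintegral_add_left measurable_const, lintegral_const, measure_univ, mul_one]
  rfl

/-- The value function is a lower bound for the cost of every bi-causal coupling. -/
lemma valueFn_zero_le_AW2sq (μ ν : ProbabilityMeasure (PathSpace d T)) (x y : PathSpace d 0) :
    valueFn μ ν 0 x y ≤ AW2sq μ ν := by
  refine le_iInf₂ fun π hπ => ?_
  -- The submartingale property. By bi-causality the next-step law of `π` is almost surely a
  -- coupling of the two one-step laws, hence costs at least the value; at time `T` only the path
  -- cost remains.
  have key : ∀ t (ht : t ≤ T), valueFn μ ν 0 x y ≤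
      ∫⁻ p, (pathCost p + valueFn μ ν t p.1 p.2)
        ∂(pairPastLaw π t ht : Measure (PathSpace d t × PathSpace d t)) := by
    intro t
    induction t with
    | zero =>
      intro ht
      calc valueFn μ ν 0 x y
          = ∫⁻ _, valueFn μ ν 0 x y
              ∂(pairPastLaw π 0 ht : Measure (PathSpace d 0 × PathSpace d 0)) := by simp
        _ ≤ _ := lintegral_mono fun p => by
          rw [Subsingleton.elim x p.1, Subsingleton.elim y p.2]
          exact le_add_self
    | succ t ih =>
      intro ht
      refine (ih (by omega)).trans ?_
      rw [pairPastLaw_succ, lintegral_pathCost_add_succ _ _ (measurable_valueFn μ ν (t + 1))]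
      refine lintegral_mono_ae ?_
      filter_upwards [hπ.2 t ht] with p hp
      obtain ⟨h1, h2⟩ := mem_Cpl_iff.1 hp
      gcongr
      rw [valueFn_of_lt μ ν t ht, pairNextKernel]
      refine otCost_le ?_ ?_
      · rw [Kernel.map_apply _ ((measurable_past _ _).prodMap (measurable_past _ _)),
          fst_map_prodMap (measurable_past _ _) (measurable_past _ _), ← coe_nextLaw]
        exact congrArg (Measure.map _) h1
      · rw [Kernel.map_apply _ ((measurable_past _ _).prodMap (measurable_past _ _)),
          snd_map_prodMap (measurable_past _ _) (measurable_past _ _), ← coe_nextLaw]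
        exact congrArg (Measure.map _) h2
  refine (key T le_rfl).trans_eq ?_
  have hid : (pairPastLaw π T le_rfl : Measure (PathSpace d T × PathSpace d T)) = π :=
    Measure.map_id
  rw [hid]
  refine lintegral_congr fun p => ?_
  rw [valueFn_of_le μ ν T le_rfl, add_zero]
  rfl

/-! ### Composing one-step kernels into a law of pairs of paths. -/

section Compositions

variable {A B A' B' : Type*} [MeasurableSpace A] [MeasurableSpace B] [MeasurableSpace A']
  [MeasurableSpace B']

lemma map_prodMap_compProd {m : Measure A} [SFinite m] {κ : Kernel A B} [IsSFiniteKernel κ]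
    {κ' : Kernel A' B'} [IsSFiniteKernel κ'] {f : A → A'} {g : B → B'} (hf : Measurable f)
    (hg : Measurable g) (h : ∀ a, (κ a).map g = κ' (f a)) :
    (m ⊗ₘ κ).map (Prod.map f g) = m.map f ⊗ₘ κ' := by
  ext s hs
  rw [Measure.map_apply (hf.prodMap hg) hs, Measure.compProd_apply ((hf.prodMap hg) hs),
    Measure.compProd_apply hs, lintegral_map (Kernel.measurable_kernel_prodMk_left hs) hf]
  refine lintegral_congr fun a => ?_
  rw [← h a, Measure.map_apply hg (measurable_prodMk_left hs)]
  rfl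

lemma lintegral_map_compProd {m : Measure A} [SFinite m] {κ : Kernel A B} [IsSFiniteKernel κ]
    {g : A × B → A'} (hg : Measurable g) {f : A' → ℝ≥0∞} (hf : Measurable f) :
    ∫⁻ x, f x ∂((m ⊗ₘ κ).map g) = ∫⁻ a, ∫⁻ b, f (g (a, b)) ∂(κ a) ∂m := by
  rw [lintegral_map hf hg]
  exact Measure.lintegral_compProd (hf.comp hg)

/-- One of the two projections of a product. -/
def side {α : Type*} (b : Bool) (p : α × α) : α := if b then p.1 else p.2

lemma measurable_side {α : Type*} [MeasurableSpace α] (b : Bool) :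
    Measurable (side b : α × α → α) := by
  cases b
  · exact measurable_snd
  · exact measurable_fst

lemma side_prodMap {α β : Type*} (b : Bool) (f : α → β) (p : α × α) :
    side b (Prod.map f f p) = f (side b p) := by
  cases b <;> rfl

end Compositions

lemma side_snocPair {t : ℕ} (b : Bool)
    (p : (PathSpace d t × PathSpace d t) × (PathSpace d 1 × PathSpace d 1)) :
    side b (snocPair p) = snoc (side b p.1, side b p.2) := by
  cases b <;> rfl

section ForwardLaw

variable (Q : ∀ t, Kernel (PathSpace d t × PathSpace d t) (PathSpace d 1 × PathSpace d 1))

/-- The law of a pair of paths built from one-step transition kernels. -/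
noncomputable def forwardLaw : ∀ t, Measure (PathSpace d t × PathSpace d t)
  | 0 => Measure.dirac default
  | t + 1 => (forwardLaw t ⊗ₘ Q t).map snocPair

variable [∀ t, IsMarkovKernel (Q t)]

instance (t : ℕ) : IsProbabilityMeasure (forwardLaw Q t) := by
  induction t with
  | zero => exact Measure.dirac.isProbabilityMeasure
  | succ t ih => exact Measure.isProbabilityMeasure_map measurable_snocPair.aemeasurable

lemma measurable_pastPair {s t : ℕ} (ht : t ≤ s) :
    Measurable (Prod.map (past t ht) (past t ht) : PathSpace d s × PathSpace d s → _) :=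
  (measurable_past t ht).prodMap (measurable_past t ht)

lemma pastPair_snocPair {s : ℕ}
    (p : (PathSpace d s × PathSpace d s) × (PathSpace d 1 × PathSpace d 1)) :
    Prod.map (past s s.le_succ) (past s s.le_succ) (snocPair p) = p.1 :=
  Prod.ext (past_snoc le_rfl p.1.1 p.2.1) (past_snoc le_rfl p.1.2 p.2.2)

lemma map_past_forwardLaw_succ (s : ℕ) :
    (forwardLaw Q (s + 1)).map (Prod.map (past s s.le_succ) (past s s.le_succ)) =
      forwardLaw Q s := by
  rw [forwardLaw, Measure.map_map (measurable_pastPair _) measurable_snocPair]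
  have : Prod.map (past s s.le_succ) (past s s.le_succ) ∘ snocPair (d := d) = Prod.fst :=
    funext pastPair_snocPair
  rw [this]
  exact Measure.fst_compProd _ _

lemma map_past_forwardLaw {t s : ℕ} (ht : t ≤ s) :
    (forwardLaw Q s).map (Prod.map (past t ht) (past t ht)) = forwardLaw Q t := by
  induction s, ht using Nat.le_induction with
  | base => exact Measure.map_id
  | succ s ht ih =>
    rw [← ih, ← map_past_forwardLaw_succ Q s, Measure.map_map (measurable_pastPair _)
      (measurable_pastPair _)]
    rfl

variable {Q} {μ : ProbabilityMeasure (PathSpace d T)} {b : Bool}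

/-- By `hQ`, the step of one component depends on its own past alone, so its law satisfies the
recursion `pastLaw_succ` of `μ`. -/
lemma map_side_forwardLaw
    (hQ : ∀ t (ht : t < T) p, (Q t p).map (side b) = nextKernel μ t ht (side b p)) :
    ∀ t (ht : t ≤ T), (forwardLaw Q t).map (side b) = (pastLaw μ t ht : Measure _) := by
  intro t
  induction t with
  | zero =>
    intro ht
    have := Measure.isProbabilityMeasure_map (μ := forwardLaw Q 0)
      (measurable_side b).aemeasurable
    ext s hs
    rcases s.eq_empty_or_nonempty with rfl | hne
    · simp
    · obtain rfl := Subsingleton.eq_univ_of_nonempty hne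
      simp
  | succ t ih =>
    intro ht
    rw [pastLaw_succ, ← ih (by omega), ← map_prodMap_compProd (measurable_side b)
      (measurable_side b) (hQ t ht), forwardLaw,
      Measure.map_map (measurable_side b) measurable_snocPair,
      Measure.map_map measurable_snoc ((measurable_side b).prodMap (measurable_side b))]
    exact congrArg (fun f => Measure.map f _) (funext fun p => side_snocPair b p)

end ForwardLaw

/-! ### Conditional laws of whole paths. -/

section PathKernel

variable (μ : ProbabilityMeasure (PathSpace d T))

/-- The kernel of conditional laws of the whole path given its past. -/
noncomputable def pathKernel (t : ℕ) (ht : t ≤ T) : Kernel (PathSpace d t) (PathSpace d T) :=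
  condDistrib id (past t ht) (μ : Measure (PathSpace d T))

instance (t : ℕ) (ht : t ≤ T) : IsMarkovKernel (pathKernel μ t ht) := by
  unfold pathKernel; infer_instance

lemma pastLaw_compProd_pathKernel (t : ℕ) (ht : t ≤ T) :
    (pastLaw μ t ht : Measure _) ⊗ₘ pathKernel μ t ht =
      (μ : Measure (PathSpace d T)).map fun x => (past t ht x, x) :=
  compProd_map_condDistrib measurable_id.aemeasurable

/-- The tower property of conditional laws. -/
lemma pathKernel_tower (t : ℕ) (ht : t < T) {B : Set (PathSpace d T)} (hB : MeasurableSet B) :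
    ∀ᵐ x ∂(pastLaw μ t ht.le : Measure (PathSpace d t)), pathKernel μ t ht.le x B =
      ∫⁻ e, pathKernel μ (t + 1) ht (snoc (x, e)) B ∂(nextKernel μ t ht x) := by
  let η : Kernel (PathSpace d t) (PathSpace d T) :=
    (nextKernel μ t ht ⊗ₖ (pathKernel μ (t + 1) ht).comap snoc measurable_snoc).snd
  have hη : ∀ x {B : Set (PathSpace d T)}, MeasurableSet B → η x B =
      ∫⁻ e, pathKernel μ (t + 1) ht (snoc (x, e)) B ∂(nextKernel μ t ht x) := by
    intro x B hB
    rw [Kernel.snd_apply' _ _ hB, Kernel.compProd_apply (measurable_snd hB)]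
    rfl
  -- Uniqueness of conditional distributions: `η` need only disintegrate the same joint law. This is
  -- checked on rectangles, with `A` pulled back to pasts of length `t + 1`.
  have h : pathKernel μ t ht.le =ᵐ[(pastLaw μ t ht.le : Measure _)] η := by
    refine condDistrib_ae_eq_of_measure_eq_compProd _ measurable_id.aemeasurable ?_
    have hm : Measurable fun x : PathSpace d T => (past t ht.le x, id x) :=
      (measurable_past _ _).prodMk measurable_id
    have hm' : Measurable fun x : PathSpace d T => (past (t + 1) ht x, x) :=
      (measurable_past _ _).prodMk measurable_id
    have := Measure.isProbabilityMeasure_map (μ := (μ : Measure (PathSpace d T))) hm.aemeasurable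
    refine Measure.ext_prod fun {A B} hA hB => ?_
    have hmB : Measurable fun x => pathKernel μ (t + 1) ht x B :=
      Kernel.measurable_coe _ hB
    have hpA : MeasurableSet (past t (Nat.le_succ t) ⁻¹' A : Set (PathSpace d (t + 1))) :=
      measurable_past _ _ hA
    have e1 : (μ : Measure (PathSpace d T)).map (fun x => (past t ht.le x, id x)) (A ×ˢ B) =
        ((pastLaw μ (t + 1) ht : Measure _) ⊗ₘ pathKernel μ (t + 1) ht)
          ((past t (Nat.le_succ t) ⁻¹' A) ×ˢ B) := by
      rw [pastLaw_compProd_pathKernel, Measure.map_apply hm (hA.prod hB),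
        Measure.map_apply hm' (hpA.prod hB)]
      rfl
    rw [e1, Measure.compProd_apply_prod hpA hB, Measure.compProd_apply_prod hA hB,
      ← lintegral_indicator hpA, pastLaw_succ,
      lintegral_map_compProd measurable_snoc (hmB.indicator hpA), ← lintegral_indicator hA]
    refine lintegral_congr fun x => ?_
    have hx : ∀ e : PathSpace d 1, past t (Nat.le_succ t) (snoc (x, e)) = x :=
      fun e => past_snoc le_rfl x e
    by_cases hxA : x ∈ A
    · simp [Set.indicator, hx, hxA, hη x hB]
    · simp [Set.indicator, hx, hxA]
  filter_upwards [h] with x hx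
  rw [hx, hη x hB]

end PathKernel

/-! ### Bi-causality of the composed law. -/

section Bicausal

variable {Q : ∀ t, Kernel (PathSpace d t × PathSpace d t) (PathSpace d 1 × PathSpace d 1)}
  [∀ t, IsMarkovKernel (Q t)] {μ : ProbabilityMeasure (PathSpace d T)} {b : Bool}

/-- Integrating out the last step of the pair uses only its `side b` marginal, which is the one-step
law of `μ`; the tower property then applies. Whole paths are used instead of futures so that the
target space does not vary with `t`. -/
lemma map_forwardLaw_compProd_pathKernel_succ
    (hQ : ∀ t (ht : t < T) p, (Q t p).map (side b) = nextKernel μ t ht (side b p))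
    (t : ℕ) (ht : t < T) :
    (forwardLaw Q (t + 1) ⊗ₘ (pathKernel μ (t + 1) ht).comap (side b) (measurable_side b)).map
      (Prod.map (Prod.map (past t t.le_succ) (past t t.le_succ)) id) =
      forwardLaw Q t ⊗ₘ (pathKernel μ t ht.le).comap (side b) (measurable_side b) := by
  have hm : Measurable (Prod.map (Prod.map (past t t.le_succ) (past t t.le_succ)) id :
      (PathSpace d (t + 1) × PathSpace d (t + 1)) × PathSpace d T → _) :=
    (measurable_pastPair _).prodMap measurable_id
  have := Measure.isProbabilityMeasure_map (μ := forwardLaw Q (t + 1) ⊗ₘ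
    (pathKernel μ (t + 1) ht).comap (side b) (measurable_side b)) hm.aemeasurable
  refine Measure.ext_prod fun {A B} hA hB => ?_
  set P := Prod.map (past (d := d) t t.le_succ) (past (d := d) t t.le_succ) with hP
  have hPA : MeasurableSet (P ⁻¹' A) := measurable_pastPair _ hA
  have hmB : Measurable fun p => (pathKernel μ (t + 1) ht).comap (side b) (measurable_side b) p B :=
    Kernel.measurable_coe _ hB
  have hmB' : Measurable fun x => pathKernel μ (t + 1) ht x B := Kernel.measurable_coe _ hB
  rw [Measure.map_apply hm (hA.prod hB),
    show Prod.map P id ⁻¹' A ×ˢ B = (P ⁻¹' A) ×ˢ B from rfl,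
    Measure.compProd_apply_prod hPA hB, Measure.compProd_apply_prod hA hB,
    ← lintegral_indicator hPA, ← lintegral_indicator hA, forwardLaw,
    lintegral_map_compProd measurable_snocPair (hmB.indicator hPA)]
  have htower := pathKernel_tower μ t ht hB
  rw [← map_side_forwardLaw hQ t ht.le] at htower
  refine lintegral_congr_ae ?_
  filter_upwards [ae_of_ae_map (measurable_side b).aemeasurable htower] with p hp
  have hPp : ∀ q, P (snocPair (p, q)) = p := fun q => pastPair_snocPair (p, q)
  by_cases hpA : p ∈ A
  · simp only [Set.indicator, Set.mem_preimage, hPp, hpA, if_true, Kernel.comap_apply]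
    have hmx : Measurable fun e => pathKernel μ (t + 1) ht (snoc (side b p, e)) B :=
      hmB'.comp (measurable_snoc.comp measurable_prodMk_left)
    rw [hp, ← hQ t ht p, lintegral_map hmx (measurable_side b)]
    simp only [side_snocPair]
  · simp [Set.indicator, hPp, hpA]

/-- The previous identity is iterated between `t` and `T`. At time `T` the path kernel is the
identity, so the conditional law of a whole component given both pasts depends on its own past only.
-/
lemma map_forwardLaw_eq_compProd_pathKernel
    (hQ : ∀ t (ht : t < T) p, (Q t p).map (side b) = nextKernel μ t ht (side b p))
    (t : ℕ) (ht : t ≤ T) :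
    (forwardLaw Q T).map (fun p => (Prod.map (past t ht) (past t ht) p, side b p)) =
      forwardLaw Q t ⊗ₘ (pathKernel μ t ht).comap (side b) (measurable_side b) := by
  have key : ∀ s (hts : t ≤ s) (hs : s ≤ T),
      (forwardLaw Q s ⊗ₘ (pathKernel μ s hs).comap (side b) (measurable_side b)).map
        (Prod.map (Prod.map (past t hts) (past t hts)) id) =
      forwardLaw Q t ⊗ₘ (pathKernel μ t ht).comap (side b) (measurable_side b) := by
    intro s hts
    induction s, hts using Nat.le_induction with
    | base => exact fun _ => Measure.map_id
    | succ s hts ih =>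
      intro hs
      rw [← ih (by omega), ← map_forwardLaw_compProd_pathKernel_succ hQ s hs,
        Measure.map_map ((measurable_pastPair _).prodMap measurable_id)
          ((measurable_pastPair _).prodMap measurable_id)]
      rfl
  rw [← key T ht le_rfl]
  have hid : (pathKernel μ T le_rfl).comap (side b) (measurable_side b) =ᵐ[forwardLaw Q T]
      Kernel.deterministic (side b) (measurable_side b) := by
    have h : pathKernel μ T le_rfl =ᵐ[(μ : Measure (PathSpace d T)).map (past T le_rfl)]
        Kernel.id := condDistrib_self _
    rw [← coe_pastLaw, ← map_side_forwardLaw hQ T le_rfl] at h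
    filter_upwards [ae_of_ae_map (measurable_side b).aemeasurable h] with p hp
    rw [Kernel.comap_apply, hp, Kernel.id_apply, Kernel.deterministic_apply]
  have hm : Measurable fun p : PathSpace d T × PathSpace d T => (p, side b p) :=
    measurable_id.prodMk (measurable_side b)
  rw [Measure.compProd_congr hid, Measure.compProd_deterministic,
    Measure.map_map ((measurable_pastPair _).prodMap measurable_id) hm]
  rfl

/-- Both components of the pair of paths built from couplings of the one-step conditional laws are
conditionally independent of the past of the other component. -/
lemma map_side_pairCondKernel
    (hQ : ∀ t (ht : t < T) p, (Q t p).map (side b) = nextKernel μ t ht (side b p))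
    {π : ProbabilityMeasure (PathSpace d T × PathSpace d T)}
    (hπ : (π : Measure (PathSpace d T × PathSpace d T)) = forwardLaw Q T) (t : ℕ) (ht : t ≤ T) :
    ∀ᵐ p ∂(pairPastLaw π t ht : Measure (PathSpace d t × PathSpace d t)),
      (pairCondKernel π t ht p).map (side b) = condKernel μ t ht (side b p) := by
  have hlaw : (pairPastLaw π t ht : Measure (PathSpace d t × PathSpace d t)) = forwardLaw Q t := by
    rw [coe_pairPastLaw, hπ, map_past_forwardLaw]
  have hmS : Measurable (side b : PathSpace d (T - t) × PathSpace d (T - t) → _) :=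
    measurable_side b
  have hfut : (pathKernel μ t ht).map (future t) =ᵐ[(pastLaw μ t ht : Measure _)]
      condKernel μ t ht := (condDistrib_comp _ measurable_id.aemeasurable
        (measurable_future t)).symm
  have hfut' : ((pathKernel μ t ht).comap (side b) (measurable_side b)).map (future t)
      =ᵐ[(pairPastLaw π t ht : Measure _)]
      (condKernel μ t ht).comap (side b) (measurable_side b) := by
    rw [← map_side_forwardLaw hQ t ht, ← hlaw] at hfut
    filter_upwards [ae_of_ae_map (measurable_side b).aemeasurable hfut] with p hp
    rw [Kernel.comap_apply, ← hp, Kernel.map_apply _ (measurable_future _),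
      Kernel.map_apply _ (measurable_future _), Kernel.comap_apply]
  -- Both kernels disintegrate the joint law of the past of the pair and the future of one
  -- component, hence agree almost everywhere.
  have heq : (pairPastLaw π t ht : Measure _) ⊗ₘ (pairCondKernel π t ht).map (side b) =
      (pairPastLaw π t ht : Measure _) ⊗ₘ
        (condKernel μ t ht).comap (side b) (measurable_side b) := by
    have hm1 : Measurable fun p : PathSpace d T × PathSpace d T =>
        (Prod.map (past t ht) (past t ht) p, side b p) :=
      (measurable_pastPair ht).prodMk (measurable_side b)
    have hm2 : Measurable fun p : PathSpace d T × PathSpace d T =>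
        (Prod.map (past t ht) (past t ht) p, Prod.map (future t) (future t) p) :=
      (measurable_pastPair ht).prodMk ((measurable_future _).prodMap (measurable_future _))
    rw [← Measure.compProd_congr hfut', Measure.compProd_map hmS,
      pairPastLaw_compProd_pairCondKernel, Measure.compProd_map (measurable_future t), hlaw,
      ← map_forwardLaw_eq_compProd_pathKernel hQ t ht, hπ,
      Measure.map_map (measurable_id.prodMap hmS) hm2,
      Measure.map_map (measurable_id.prodMap (measurable_future t)) hm1]
    exact congrArg (fun f => Measure.map f _)
      (funext fun p => Prod.ext rfl (side_prodMap b (future t) p))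
  have : IsMarkovKernel ((pairCondKernel π t ht).map (side b)) := Kernel.IsMarkovKernel.map _ hmS
  filter_upwards [Kernel.ae_eq_of_compProd_eq heq] with p hp
  rw [← Kernel.map_apply _ hmS, hp, Kernel.comap_apply]

/-- Composing couplings of the one-step conditional laws yields a bi-causal coupling. -/
theorem exists_mem_CplBC_of_kernels (μ ν : ProbabilityMeasure (PathSpace d T))
    (h1 : ∀ t (ht : t < T) p, (Q t p).fst = nextKernel μ t ht p.1)
    (h2 : ∀ t (ht : t < T) p, (Q t p).snd = nextKernel ν t ht p.2) :
    ∃ π ∈ CplBC μ ν, (π : Measure (PathSpace d T × PathSpace d T)) = forwardLaw Q T := by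
  refine ⟨⟨forwardLaw Q T, inferInstance⟩, ⟨mem_Cpl_iff.2 ⟨?_, ?_⟩, fun t ht => ?_⟩, rfl⟩
  · exact (map_side_forwardLaw (b := true) h1 T le_rfl).trans Measure.map_id
  · exact (map_side_forwardLaw (b := false) h2 T le_rfl).trans Measure.map_id
  · filter_upwards [map_side_pairCondKernel (b := true) h1 rfl t ht.le,
      map_side_pairCondKernel (b := false) h2 rfl t ht.le] with p hp1 hp2
    exact mem_Cpl_iff.2 ⟨hp1, hp2⟩

end Bicausal

/-! ### Optimality of the composed coupling. -/

/-- The value function at time zero is the adapted Wasserstein distance, and it is attained. -/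
theorem valueFn_zero_eq_AW2sq (μ ν : ProbabilityMeasure (PathSpace d T)) :
    (∀ x y : PathSpace d 0, valueFn μ ν 0 x y = AW2sq μ ν) ∧ (CplBC μ ν).Nonempty := by
  have hex : ∀ t, ∃ Q : Kernel (PathSpace d t × PathSpace d t) (PathSpace d 1 × PathSpace d 1),
      IsMarkovKernel Q ∧ ∀ (ht : t < T) p, (Q p).fst = nextKernel μ t ht p.1 ∧
        (Q p).snd = nextKernel ν t ht p.2 ∧
        ∫⁻ q, (‖q.1 0 - q.2 0‖ₑ ^ 2 + valueFn μ ν (t + 1) (snoc (p.1, q.1)) (snoc (p.2, q.2)))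
          ∂(Q p) = valueFn μ ν t p.1 p.2 := by
    intro t
    by_cases ht : t < T
    · obtain ⟨Q, hQ, h⟩ := exists_optimal_kernel μ ν t ht
      exact ⟨Q, hQ, fun _ => h⟩
    -- From time `T` on, any Markov kernel will do.
    · exact ⟨Kernel.const _ (Measure.dirac default), inferInstance, fun h => absurd h ht⟩
  choose Q hQ h using hex
  obtain ⟨π, hπ, hπQ⟩ := exists_mem_CplBC_of_kernels μ ν (fun t ht p => (h t ht p).1)
    fun t ht p => (h t ht p).2.1
  refine ⟨fun x y => le_antisymm (valueFn_zero_le_AW2sq μ ν x y) ?_, π, hπ⟩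
  -- For optimal kernels, running cost plus value has constant expectation.
  have key : ∀ t ≤ T, ∫⁻ p, (pathCost p + valueFn μ ν t p.1 p.2) ∂(forwardLaw Q t) =
      valueFn μ ν 0 x y := by
    intro t
    induction t with
    | zero =>
      intro _
      have : ∀ p : PathSpace d 0 × PathSpace d 0,
          pathCost p + valueFn μ ν 0 p.1 p.2 = valueFn μ ν 0 x y := fun p => by
        rw [Subsingleton.elim x p.1, Subsingleton.elim y p.2, pathCost,
          Finset.univ_eq_empty, Finset.sum_empty, zero_add]
      simp_rw [this]
      rw [lintegral_const, measure_univ, mul_one]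
    | succ t ih =>
      intro ht
      rw [← ih (by omega), forwardLaw,
        lintegral_pathCost_add_succ _ _ (measurable_valueFn μ ν (t + 1))]
      exact lintegral_congr fun p => by rw [(h t ht p).2.2]
  calc AW2sq μ ν ≤ ∫⁻ p, pathCost p ∂(π : Measure (PathSpace d T × PathSpace d T)) :=
        iInf₂_le π hπ
    _ = ∫⁻ p, (pathCost p + valueFn μ ν T p.1 p.2) ∂(forwardLaw Q T) := by
        rw [hπQ]
        exact lintegral_congr fun p => by rw [valueFn_of_le μ ν T le_rfl, add_zero]
    _ = valueFn μ ν 0 x y := key T le_rfl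

/-! ### Value functions of the conditional laws. -/

/-- `(x_{1:t}, x_{t+1:t+s}) ↦ x_{1:t+s}`. -/
def concat {t s : ℕ} (x : PathSpace d t) (x' : PathSpace d s) : PathSpace d (t + s) :=
  Fin.append x x'

lemma measurable_concat_prod {t s : ℕ} :
    Measurable fun p : PathSpace d t × PathSpace d s => concat p.1 p.2 := measurable_append t s

lemma measurable_concat {t s : ℕ} (x : PathSpace d t) :
    Measurable (concat x : PathSpace d s → PathSpace d (t + s)) :=
  (measurable_append t s).comp measurable_prodMk_left

/-- Both sides have the same type because `t + (s + 1)` reduces to `t + s + 1`. -/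
lemma concat_snoc {t s : ℕ} (x : PathSpace d t) (x' : PathSpace d s) (e : PathSpace d 1) :
    concat x (snoc (x', e)) = snoc (concat x x', e) := by
  have := Fin.append_assoc x x' e
  simp only [concat, snoc, this]
  rfl

lemma concat_zero {t : ℕ} (x : PathSpace d t) (x' : PathSpace d 0) : concat x x' = x := by
  funext i
  exact Fin.append_left x x' i

lemma concat_past_future {t s : ℕ} (h : t + s ≤ T) (x : PathSpace d T) :
    concat (past t (by omega) x) (past s (by omega) (future t x)) = past (t + s) h x := by
  funext i
  induction i using Fin.addCases with
  | left i => simp only [concat, Fin.append_left, past]; rfl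
  | right i => simp only [concat, Fin.append_right, past, future]; rfl

/-- The inverse of concatenation. -/
def split {t s : ℕ} (x : PathSpace d (t + s)) : PathSpace d t × PathSpace d s :=
  (past t (by omega) x, fun i => x (Fin.natAdd t i))

lemma measurable_split {t s : ℕ} :
    Measurable (split : PathSpace d (t + s) → PathSpace d t × PathSpace d s) :=
  (measurable_past _ _).prodMk (measurable_pi_lambda _ fun _ => measurable_pi_apply _)

lemma split_concat {t s : ℕ} (p : PathSpace d t × PathSpace d s) :
    split (concat p.1 p.2) = p :=
  Prod.ext (funext fun i => Fin.append_left p.1 p.2 i) (funext fun i => Fin.append_right p.1 p.2 i)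

/-- The law of `x_{1:t+s}` by conditioning on `x_{1:t}`. -/
lemma pastLaw_add (μ : ProbabilityMeasure (PathSpace d T)) (t s : ℕ) (h : t + s ≤ T) :
    (pastLaw μ (t + s) h : Measure (PathSpace d (t + s))) =
      ((pastLaw μ t (by omega) : Measure _) ⊗ₘ
        (condKernel μ t (by omega)).map (past s (by omega))).map fun p => concat p.1 p.2 := by
  have hm : Measurable fun x : PathSpace d T =>
      (past t (by omega : t ≤ T) x, future t x) :=
    (measurable_past _ _).prodMk (measurable_future _)
  rw [Measure.compProd_map (measurable_past _ _), pastLaw_compProd_condKernel,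
    Measure.map_map (measurable_id.prodMap (measurable_past _ _)) hm,
    Measure.map_map measurable_concat_prod
      ((measurable_id.prodMap (measurable_past _ _)).comp hm), coe_pastLaw]
  exact congrArg (fun f => Measure.map f (μ : Measure (PathSpace d T)))
    (funext fun x => (concat_past_future h x).symm)

/-- The one-step conditional laws of `μ_{x_{1:t}}` are those of `μ`. -/
lemma ae_nextKernel_condLaw (μ : ProbabilityMeasure (PathSpace d T)) (t : ℕ) (ht : t ≤ T) (s : ℕ)
    (hs : s < T - t) :
    ∀ᵐ x ∂(pastLaw μ t ht : Measure (PathSpace d t)),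
      ∀ᵐ x' ∂(pastLaw (condLaw μ t ht x) s hs.le : Measure (PathSpace d s)),
        nextKernel (condLaw μ t ht x) s hs x' =
          nextKernel μ (t + s) (by omega) (concat x x') := by
  set m := (pastLaw μ t ht : Measure (PathSpace d t)) with hm
  -- Two versions of the law of the next `s` steps and the step after them, given the first `t`: `κ`
  -- is read off from the conditional law of the future, `η` inserts the one-step law of `μ` at time
  -- `t + s`.
  let κ : Kernel (PathSpace d t) (PathSpace d s × PathSpace d 1) :=
    (condKernel μ t ht).map fun y => (past s hs.le y, past 1 (by omega) (future s y))
  let η : Kernel (PathSpace d t) (PathSpace d s × PathSpace d 1) :=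
    (condKernel μ t ht).map (past s hs.le) ⊗ₖ
      (nextKernel μ (t + s) (by omega)).comap (fun p => concat p.1 p.2) measurable_concat_prod
  have hmf : Measurable fun y : PathSpace d (T - t) =>
      (past s hs.le y, past 1 (by omega : 1 ≤ T - t - s) (future s y)) :=
    (measurable_past _ _).prodMk ((measurable_past _ _).comp (measurable_future _))
  have : IsMarkovKernel ((condKernel μ t ht).map (past s hs.le)) :=
    Kernel.IsMarkovKernel.map _ (measurable_past _ _)
  have : IsMarkovKernel κ := Kernel.IsMarkovKernel.map _ hmf
  have heq : m ⊗ₘ κ = m ⊗ₘ η := by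
    have hms : Measurable fun p : PathSpace d (t + s) × PathSpace d 1 => (split p.1, p.2) :=
      (measurable_split.comp measurable_fst).prodMk measurable_snd
    have hmc : Measurable fun p : PathSpace d t × PathSpace d s => concat p.1 p.2 :=
      measurable_concat_prod
    have e1 : (m ⊗ₘ (condKernel μ t ht).map (past s hs.le)) ⊗ₘ
        (nextKernel μ (t + s) (by omega)).comap (fun p => concat p.1 p.2) measurable_concat_prod =
        ((pastLaw μ (t + s) (by omega) : Measure _) ⊗ₘ nextKernel μ (t + s) (by omega)).map
          fun p => (split p.1, p.2) := by
      have hsplit : (fun p : PathSpace d (t + s) × PathSpace d 1 => (split p.1, p.2)) ∘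
          Prod.map (fun p : PathSpace d t × PathSpace d s => concat p.1 p.2) id = id :=
        funext fun p => Prod.ext (split_concat p.1) rfl
      rw [pastLaw_add μ t s (by omega), ← map_prodMap_compProd hmc measurable_id (κ :=
        (nextKernel μ (t + s) (by omega)).comap (fun p => concat p.1 p.2) measurable_concat_prod)
        (fun a => by rw [Measure.map_id, Kernel.comap_apply]),
        Measure.map_map hms (hmc.prodMap measurable_id), hsplit, Measure.map_id]
    have hpf : Measurable fun x : PathSpace d T => (past t ht x, future t x) :=
      (measurable_past _ _).prodMk (measurable_future _)
    have hpn : Measurable fun x : PathSpace d T =>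
        (past (t + s) (by omega : t + s ≤ T) x,
          past 1 (by omega : 1 ≤ T - (t + s)) (future (t + s) x)) :=
      (measurable_past _ _).prodMk ((measurable_past _ _).comp (measurable_future _))
    rw [← Measure.compProd_assoc', e1, pastLaw_compProd_nextKernel, Measure.compProd_map hmf,
      pastLaw_compProd_condKernel, Measure.map_map (measurable_id.prodMap hmf) hpf,
      Measure.map_map hms hpn, Measure.map_map MeasurableEquiv.prodAssoc.measurable
        (hms.comp hpn)]
    refine congrArg (fun f => Measure.map f (μ : Measure (PathSpace d T))) (funext fun x => ?_)
    refine Prod.ext rfl (Prod.ext rfl (funext fun i => ?_))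
    exact congrArg x (Fin.ext (Nat.add_assoc t s i).symm)
  filter_upwards [Kernel.ae_eq_of_compProd_eq heq] with x hx
  -- For fixed `x`, the equality `κ x = η x` gives two disintegrations of one law over the first `s`
  -- steps; uniqueness is used a second time.
  have h1 : (pastLaw (condLaw μ t ht x) s hs.le : Measure _) ⊗ₘ
      nextKernel (condLaw μ t ht x) s hs =
      (pastLaw (condLaw μ t ht x) s hs.le : Measure _) ⊗ₘ
        (nextKernel μ (t + s) (by omega)).comap (concat x) (measurable_concat x) := by
    have hsect : η x = (pastLaw (condLaw μ t ht x) s hs.le : Measure _) ⊗ₘ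
        (nextKernel μ (t + s) (by omega)).comap (concat x) (measurable_concat x) := by
      rw [Kernel.compProd_apply_eq_compProd_sectR, Kernel.map_apply _ (measurable_past _ _)]
      rfl
    rw [pastLaw_compProd_nextKernel, ← hsect, ← hx, Kernel.map_apply _ hmf]
    rfl
  filter_upwards [Kernel.ae_eq_of_compProd_eq h1] with x' hx'
  rw [hx', Kernel.comap_apply]

/-- A null set of one marginal is null for every coupling. Exceptional sets must therefore be kept
separate for the two variables, which is why the results are stated with `A` and `B`. -/
lemma otCost_congr_ae {E F : Type*} [MeasurableSpace E] [MeasurableSpace F] {c c' : E × F → ℝ≥0∞}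
    {μ : Measure E} {ν : Measure F} {A : Set E} {B : Set F} (hA : ∀ᵐ x ∂μ, x ∈ A)
    (hB : ∀ᵐ y ∂ν, y ∈ B) (h : ∀ p : E × F, p.1 ∈ A → p.2 ∈ B → c p = c' p) :
    otCost c μ ν = otCost c' μ ν := by
  refine iInf_congr fun π => iInf_congr fun hπ => lintegral_congr_ae ?_
  rw [← hπ.1] at hA
  rw [← hπ.2] at hB
  filter_upwards [ae_of_ae_map measurable_fst.aemeasurable hA,
    ae_of_ae_map measurable_snd.aemeasurable hB] with p h1 h2 using h p h1 h2

/-- For almost every `x_{1:t}`, the value functions of `μ_{x_{1:t}}` agree with the shifted value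
functions of `μ` as soon as the one-step conditional laws do. -/
lemma valueFn_condLaw_eq (μ ν : ProbabilityMeasure (PathSpace d T)) {t : ℕ} (ht : t ≤ T)
    {x y : PathSpace d t}
    (hx : ∀ s (hs : s < T - t),
      ∀ᵐ x' ∂(pastLaw (condLaw μ t ht x) s hs.le : Measure (PathSpace d s)),
        nextKernel (condLaw μ t ht x) s hs x' =
          nextKernel μ (t + s) (by omega) (concat x x'))
    (hy : ∀ s (hs : s < T - t),
      ∀ᵐ y' ∂(pastLaw (condLaw ν t ht y) s hs.le : Measure (PathSpace d s)),
        nextKernel (condLaw ν t ht y) s hs y' =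
          nextKernel ν (t + s) (by omega) (concat y y'))
    (s : ℕ) (hs : s ≤ T - t) :
    ∃ A B : Set (PathSpace d s),
      (∀ᵐ x' ∂(pastLaw (condLaw μ t ht x) s hs : Measure (PathSpace d s)), x' ∈ A) ∧
      (∀ᵐ y' ∂(pastLaw (condLaw ν t ht y) s hs : Measure (PathSpace d s)), y' ∈ B) ∧
      ∀ x' ∈ A, ∀ y' ∈ B, valueFn (condLaw μ t ht x) (condLaw ν t ht y) s x' y' =
        valueFn μ ν (t + s) (concat x x') (concat y y') := by
  induction hn : T - t - s generalizing s with
  | zero =>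
    refine ⟨Set.univ, Set.univ, by simp, by simp, fun x' _ y' _ => ?_⟩
    rw [valueFn_of_le _ _ s (by omega), valueFn_of_le _ _ (t + s) (by omega)]
  | succ n ih =>
    have hs' : s < T - t := by omega
    obtain ⟨A, B, hA, hB, h⟩ := ih (s + 1) hs' (by omega)
    -- A set of full measure at time `s + 1` is reached almost surely in one step from almost every
    -- state at time `s`.
    have step : ∀ (ρ : ProbabilityMeasure (PathSpace d (T - t))) {C : Set (PathSpace d (s + 1))},
        (∀ᵐ z ∂(pastLaw ρ (s + 1) hs' : Measure (PathSpace d (s + 1))), z ∈ C) →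
        ∀ᵐ z ∂(pastLaw ρ s hs : Measure (PathSpace d s)),
          ∀ᵐ e ∂(nextKernel ρ s hs' z), snoc (z, e) ∈ C := by
      intro ρ C hC
      rw [pastLaw_succ] at hC
      exact Measure.ae_ae_of_ae_compProd (ae_of_ae_map measurable_snoc.aemeasurable hC)
    refine ⟨{x' | nextKernel (condLaw μ t ht x) s hs' x' =
          nextKernel μ (t + s) (by omega) (concat x x') ∧
          ∀ᵐ e ∂(nextKernel (condLaw μ t ht x) s hs' x'), snoc (x', e) ∈ A},
        {y' | nextKernel (condLaw ν t ht y) s hs' y' =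
          nextKernel ν (t + s) (by omega) (concat y y') ∧
          ∀ᵐ e ∂(nextKernel (condLaw ν t ht y) s hs' y'), snoc (y', e) ∈ B},
        (hx s hs').and (step _ hA), (hy s hs').and (step _ hB), ?_⟩
    rintro x' ⟨hx1, hx2⟩ y' ⟨hy1, hy2⟩
    rw [valueFn_of_lt _ _ s hs', valueFn_of_lt _ _ (t + s) (by omega), ← hx1, ← hy1]
    refine otCost_congr_ae hx2 hy2 fun p hp1 hp2 => ?_
    rw [h _ hp1 _ hp2, concat_snoc, concat_snoc]
    rfl

/-! ### Second moments and finiteness. -/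

lemma lintegral_condKernel (μ : ProbabilityMeasure (PathSpace d T)) (t : ℕ) (ht : t ≤ T)
    {f : PathSpace d (T - t) → ℝ≥0∞} (hf : Measurable f) :
    ∫⁻ x, ∫⁻ y, f y ∂(condKernel μ t ht x) ∂(pastLaw μ t ht : Measure (PathSpace d t)) =
      ∫⁻ x, f (future t x) ∂(μ : Measure (PathSpace d T)) := by
  have hf2 : Measurable fun p : PathSpace d t × PathSpace d (T - t) => f p.2 :=
    hf.comp measurable_snd
  rw [← Measure.lintegral_compProd hf2, pastLaw_compProd_condKernel,
    lintegral_map hf2 ((measurable_past _ _).prodMk (measurable_future _))]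

lemma sum_future_le {t : ℕ} (x : PathSpace d T) :
    ∑ i, ‖future t x i‖ₑ ^ 2 ≤ ∑ i, ‖x i‖ₑ ^ 2 := by
  have hinj : Function.Injective fun i : Fin (T - t) => (⟨t + i, by omega⟩ : Fin T) := by
    intro i j h
    exact Fin.ext (Nat.add_left_cancel (Fin.mk.inj_iff.1 h))
  refine (Finset.sum_map Finset.univ ⟨_, hinj⟩ fun i => ‖x i‖ₑ ^ 2).symm.trans_le ?_
  exact Finset.sum_le_sum_of_subset (Finset.subset_univ _)

/-- Almost every conditional law has a finite second moment. -/
lemma ae_finiteSecondMoment_condLaw {μ : ProbabilityMeasure (PathSpace d T)}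
    (hμ : FiniteSecondMoment μ) (t : ℕ) (ht : t ≤ T) :
    ∀ᵐ x ∂(pastLaw μ t ht : Measure (PathSpace d t)), FiniteSecondMoment (condLaw μ t ht x) := by
  have hf : Measurable fun y : PathSpace d (T - t) => ∑ i, ‖y i‖ₑ ^ 2 := by fun_prop
  refine ae_lt_top hf.lintegral_kernel (ne_of_lt ?_)
  refine (lintegral_condKernel μ t ht hf).trans_lt ?_
  exact (lintegral_mono fun x => sum_future_le x).trans_lt hμ

/-- Some bi-causal coupling exists, and `‖a - b‖² ≤ 2 (‖a‖² + ‖b‖²)` bounds the cost of any coupling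
by the moments of its marginals. -/
lemma AW2sq_lt_top {μ ν : ProbabilityMeasure (PathSpace d T)} (hμ : FiniteSecondMoment μ)
    (hν : FiniteSecondMoment ν) : AW2sq μ ν < ∞ := by
  obtain ⟨π, hπ⟩ := (valueFn_zero_eq_AW2sq μ ν).2
  obtain ⟨h1, h2⟩ := mem_Cpl_iff.1 hπ.1
  have hm : Measurable fun x : PathSpace d T => ∑ i, ‖x i‖ₑ ^ 2 := by fun_prop
  have hbound : ∀ a b : EuclideanSpace ℝ (Fin d), ‖a - b‖ₑ ^ 2 ≤ 2 * (‖a‖ₑ ^ 2 + ‖b‖ₑ ^ 2) := by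
    intro a b
    refine (pow_le_pow_left' (enorm_sub_le (a := a) (b := b)) 2).trans ?_
    have := ENNReal.rpow_add_le_mul_rpow_add_rpow ‖a‖ₑ ‖b‖ₑ (p := 2) one_le_two
    norm_num at this
    exact_mod_cast this
  refine (iInf₂_le π hπ).trans_lt ?_
  calc ∫⁻ p, ∑ i, ‖p.1 i - p.2 i‖ₑ ^ 2 ∂(π : Measure (PathSpace d T × PathSpace d T))
      ≤ ∫⁻ p, 2 * (∑ i, ‖p.1 i‖ₑ ^ 2 + ∑ i, ‖p.2 i‖ₑ ^ 2)
          ∂(π : Measure (PathSpace d T × PathSpace d T)) := by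
        refine lintegral_mono fun p => ?_
        rw [← Finset.sum_add_distrib, Finset.mul_sum]
        exact Finset.sum_le_sum fun i _ => hbound _ _
    _ = 2 * (∫⁻ x, ∑ i, ‖x i‖ₑ ^ 2 ∂(π : Measure (PathSpace d T × PathSpace d T)).fst +
          ∫⁻ x, ∑ i, ‖x i‖ₑ ^ 2 ∂(π : Measure (PathSpace d T × PathSpace d T)).snd) := by
        rw [lintegral_const_mul _ (by fun_prop), lintegral_add_left (by fun_prop), Measure.fst,
          Measure.snd, lintegral_map hm measurable_fst, lintegral_map hm measurable_snd]
    _ < ∞ := by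
        rw [h1, h2]
        exact ENNReal.mul_lt_top (by simp) (ENNReal.add_lt_top.2 ⟨hμ, hν⟩)

end NestedOT

open NestedOT
/-- Dynamic programming principle. The conditional laws are determined up to null sets, so that
the identity at time `t` is claimed for all `x ∈ A` and `y ∈ B`, where `A` has full measure for
`μ_{1:t}` and `B` has full measure for `ν_{1:t}` (hence almost surely under every coupling of
`μ_{1:t}` and `ν_{1:t}`). -/
theorem proposition1 (d T : ℕ) (μ ν : ProbabilityMeasure (PathSpace d T))
    (hμ : FiniteSecondMoment μ) (hν : FiniteSecondMoment ν) :
    (∀ (t : ℕ) (ht : t < T), ∃ A B : Set (PathSpace d t),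
      (∀ᵐ x ∂(pastLaw μ t ht.le : Measure (PathSpace d t)), x ∈ A) ∧
      (∀ᵐ y ∂(pastLaw ν t ht.le : Measure (PathSpace d t)), y ∈ B) ∧
      ∀ x ∈ A, ∀ y ∈ B,
        valueFn μ ν t x y = AW2sq (condLaw μ t ht.le x) (condLaw ν t ht.le y) ∧
        AW2sq (condLaw μ t ht.le x) (condLaw ν t ht.le y) < ∞) ∧
    (∀ x y : PathSpace d 0, valueFn μ ν 0 x y = AW2sq μ ν) ∧
    AW2sq μ ν < ∞ := by
  refine ⟨fun t ht => ?_, (valueFn_zero_eq_AW2sq μ ν).1, AW2sq_lt_top hμ hν⟩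
  have hae : ∀ ρ : ProbabilityMeasure (PathSpace d T),
      ∀ᵐ x ∂(pastLaw ρ t ht.le : Measure (PathSpace d t)), ∀ s (hs : s < T - t),
        ∀ᵐ x' ∂(pastLaw (condLaw ρ t ht.le x) s hs.le : Measure (PathSpace d s)),
          nextKernel (condLaw ρ t ht.le x) s hs x' =
            nextKernel ρ (t + s) (by omega) (concat x x') := fun ρ =>
    ae_all_iff.2 fun s => ae_all_iff.2 fun hs => ae_nextKernel_condLaw ρ t ht.le s hs
  refine ⟨{x | _}, {y | _}, (hae μ).and (ae_finiteSecondMoment_condLaw hμ t ht.le),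
    (hae ν).and (ae_finiteSecondMoment_condLaw hν t ht.le), ?_⟩
  rintro x ⟨hx, hx2⟩ y ⟨hy, hy2⟩
  refine ⟨?_, AW2sq_lt_top hx2 hy2⟩
  -- Only `s = 0` is needed, with empty continuations; `A` and `B` are nonempty since they carry
  -- probability measures.
  obtain ⟨A, B, hA, hB, h⟩ := valueFn_condLaw_eq μ ν ht.le hx hy 0 (Nat.zero_le _)
  obtain ⟨x', hx'⟩ := hA.exists
  obtain ⟨y', hy'⟩ := hB.exists
  rw [← (valueFn_zero_eq_AW2sq _ _).1 x' y', h x' hx' y' hy']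
  exact congrArg₂ (valueFn μ ν t) (concat_zero x x').symm (concat_zero y y').symm
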